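/- **Setting.** Let $0<\varepsilon<1<b$, $T>0$, $R>0$, $\Omega=(\varepsilon,b)\times(0,T)\subset\mathbb R^2$ with points $(x,t)$. Let $H^4(\Omega)$ be the real Sobolev space with scalar product $[u,v]=\sum_{i+j\le 4}\int_\Omega \partial_x^i\partial_t^j u\,\partial_x^i\partial_t^j v\,dx\,dt$; by embedding $H^4(\Omega)\subset C^2(\overline\Omega)$, so that boundary values are classical. Put $H^4_0(\Omega)=\{v\in H^4(\Omega): v(\varepsilon,t)=v_x(\varepsilon,t)=v_x(b,t)=0,\ t\in(0,T)\}$. For $g_0:\mathbb R\to\mathbb R$ let $B(R,g_0)$ be the set of all $q\in H^4(\Omega)$ with $\|q\|_{H^4(\Omega)}<R$, $q(\varepsilon,t)=g_0(t+\varepsilon)$, $q_x(\varepsilon,t)=2g_0'(t+\varepsilon)$, $q_x(b,t)=0$ for $t\in(0,T)$, and $\frac1{2b^{1/4}}\le q(x,0)\le\frac12$ for $x\in[\varepsilon,b]$; let $\overline{B(R,g_0)}$ be its closure in $H^4(\Omega)$. We always assume $B(R,g_0)\ne\varnothing$. Let $q^0(x,0)$ be the truncation of $q(x,0)$ to $[\frac1{2b^{1/4}},\frac12]$,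 that is $q^0(x,0)=\max\{\frac1{2b^{1/4}},\min\{\frac12,q(x,0)\}\}$. For $\alpha\in(0,1/2)$ and real $\lambda,\beta$ put $e^{2\lambda\varphi}=e^{-2\lambda(x+\alpha t)}$ and define functionals on $H^4(\Omega)$ successively for $n=0,1,\dots$ by $$J^{(n)}_{\lambda,\beta}(q)=\int_\Omega\big(A_n(q)+B_n\big)^2e^{2\lambda\varphi}\,dx\,dt+\beta\|q\|^2_{H^4(\Omega)},$$ where $A_0(q)=q_{xx}-2q_{xt}$, $B_0=0$ and, for $n\ge1$, $$A_n(q)=q_{xx}-\frac{q_{xt}}{2\,(q^0_{n-1,\min}(x,0))^2},\qquad B_n=\partial_tq_{n-1,\min}(x,t)\,\frac{\partial_xq_{n-1,\min}(x,0)}{2\,(q^0_{n-1,\min}(x,0))^3},$$ with $q_{k,\min}$ a minimizer of $J^{(k)}_{\lambda,\beta}$ on $\overline{B(R,g_0)}$ for $k<n$ (same $\alpha,\lambda,\beta$). In all that follows $n\ge 0$ is any integer for which minimizers $q_{0,\min},\dots,q_{n-1,\min}$ are given. **Theorem 6.1.** 1. Let $\alpha\in(0,1/2)$ and $\lambda,\beta\in\mathbb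 R$. For every $q\in\overline{B(R,g_0)}$ the functional $J^{(n)}_{\lambda,\beta}$ has at $q$ a Fréchet derivative $(J^{(n)}_{\lambda,\beta}(q))'\in H^4_0(\Omega)$, i.e. $J^{(n)}_{\lambda,\beta}(q+h)=J^{(n)}_{\lambda,\beta}(q)+[(J^{(n)}_{\lambda,\beta}(q))',h]+o(\|h\|_{H^4(\Omega)})$ as $h\to0$ in $H^4_0(\Omega)$, and for all $h\in H_0^4(\Omega)$ $$\big(J^{(n)}_{\lambda,\beta}(q)\big)'(h):=\big[\big(J^{(n)}_{\lambda,\beta}(q)\big)',h\big]=2\int_\Omega\big(A_n(q)+B_n\big)A_n(h)\,e^{2\lambda\varphi}\,dx\,dt+2\beta[q,h].$$ 2. Under the assumptions of 1 there is a constant $D>0$ such that $\|(J^{(n)}_{\lambda,\beta}(q_2))'-(J^{(n)}_{\lambda,\beta}(q_1))'\|_{H^4(\Omega)}\le D\|q_2-q_1\|_{H^4(\Omega)}$ for all $q_1,q_2\in\overline{B(R,g_0)}$. 3. There is $\alpha_0=\alpha_0(R,\Omega)\in(0,1/2]$ such that for every $\alpha\in(0,\alpha_0)$ there are $\lambda_1=\lambda_1(R,\Omega,\alpha)>1$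 and $C=C(R,\Omega,\alpha)>0$, depending only on the listed parameters, such that for all $g_0$ with $B(R,g_0)\neq\varnothing$, all $n$, all $\lambda\ge\lambda_1$ and all $\beta\in[2e^{-\lambda\alpha T},1)$ the functional $J^{(n)}_{\lambda,\beta}$ is strictly convex on $\overline{B(R,g_0)}$ and, whenever $q,\,q+h\in\overline{B(R,g_0)}$, $$J^{(n)}_{\lambda,\beta}(q+h)-J^{(n)}_{\lambda,\beta}(q)-\big(J^{(n)}_{\lambda,\beta}(q)\big)'(h)\ge C\int_\Omega\big[\lambda(h_x^2+h_t^2)+\lambda^3h^2\big]e^{2\lambda\varphi}dx\,dt+C\int_\varepsilon^b\big(\lambda h_x^2(x,0)+\lambda^3h^2(x,0)\big)e^{-2\lambda x}dx+\frac\beta2\|h\|^2_{H^4(\Omega)}.$$ 4. For the same $\alpha,\lambda,\beta,g_0,n$ there is a unique minimizer $q_{n,\min}\in\overline{B(R,g_0)}$ of $J^{(n)}_{\lambda,\beta}$ on $\overline{B(R,g_0)}$, and $$\big[\big(J^{(n)}_{\lambda,\beta}(q)\big)',\,q-q_{n,\min}\big]\ge0\qquad\text{for all }q\in\overline{B(R,g_0)}.$$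 -/

import Mathlib

open MeasureTheory Set
open scoped ContDiff

noncomputable section

namespace Carleman1D

/-- The open rectangle `Ω = (ε, b) × (0, T)` in the `(x, t)` plane. -/
def Om (ε b T : ℝ) : Set (ℝ × ℝ) := Ioo ε b ×ˢ Ioo 0 T

/-- The closed rectangle, the closure of `Ω`. -/
def OmBar (ε b T : ℝ) : Set (ℝ × ℝ) := Icc ε b ×ˢ Icc 0 T

/-- Lebesgue measure on `Ω`. -/
def muOm (ε b T : ℝ) : Measure (ℝ × ℝ) := (volume : Measure (ℝ × ℝ)).restrict (Om ε b T)

/-- The real space `L²(Ω)`. -/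
abbrev L2 (ε b T : ℝ) : Type := Lp ℝ 2 (muOm ε b T)

/-- Classical partial derivative in `x`. -/
def dX (φ : ℝ × ℝ → ℝ) : ℝ × ℝ → ℝ := fun z => fderiv ℝ φ z (1, 0)

/-- Classical partial derivative in `t`. -/
def dT (φ : ℝ × ℝ → ℝ) : ℝ × ℝ → ℝ := fun z => fderiv ℝ φ z (0, 1)

/-- Smooth functions with compact support inside `Ω`. -/
def IsTest (ε b T : ℝ) (φ : ℝ × ℝ → ℝ) : Prop :=
  ContDiff ℝ ∞ φ ∧ HasCompactSupport φ ∧ tsupport φ ⊆ Om ε b T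

/-- `w` is the weak derivative `∂ₓⁱ ∂ₜʲ u` on `Ω`. -/
def IsWeakDeriv (ε b T : ℝ) (i j : ℕ) (u w : L2 ε b T) : Prop :=
  ∀ φ : ℝ × ℝ → ℝ, IsTest ε b T φ →
    ∫ z, u z * (dX^[i] (dT^[j] φ)) z ∂(muOm ε b T)
      = (-1) ^ (i + j) * ∫ z, w z * φ z ∂(muOm ε b T)

/-- Multi-indices `(i, j)` with `i + j ≤ 4`. -/
abbrev Idx : Type := {p : Fin 5 × Fin 5 // (p.1 : ℕ) + (p.2 : ℕ) ≤ 4}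

/-- The multi-index `(0, 0)`. -/
def idx0 : Idx := ⟨(0, 0), by decide⟩

lemma dX_smooth {φ : ℝ × ℝ → ℝ} (h : ContDiff ℝ ∞ φ) : ContDiff ℝ ∞ (dX φ) :=
  (h.fderiv_right (m := ∞) (by simp)).clm_apply contDiff_const

lemma dT_smooth {φ : ℝ × ℝ → ℝ} (h : ContDiff ℝ ∞ φ) : ContDiff ℝ ∞ (dT φ) :=
  (h.fderiv_right (m := ∞) (by simp)).clm_apply contDiff_const

lemma dX_compact {φ : ℝ × ℝ → ℝ} (h : HasCompactSupport φ) : HasCompactSupport (dX φ) :=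
  h.fderiv_apply (𝕜 := ℝ) _

lemma dT_compact {φ : ℝ × ℝ → ℝ} (h : HasCompactSupport φ) : HasCompactSupport (dT φ) :=
  h.fderiv_apply (𝕜 := ℝ) _

lemma iter_good {φ : ℝ × ℝ → ℝ} (h : ContDiff ℝ ∞ φ) (hc : HasCompactSupport φ) (i j : ℕ) :
    ContDiff ℝ ∞ (dX^[i] (dT^[j] φ)) ∧ HasCompactSupport (dX^[i] (dT^[j] φ)) := by
  have h1 : ContDiff ℝ ∞ (dT^[j] φ) ∧ HasCompactSupport (dT^[j] φ) := by
    induction j with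
    | zero => exact ⟨h, hc⟩
    | succ k ih =>
      rw [Function.iterate_succ_apply']
      exact ⟨dT_smooth ih.1, dT_compact ih.2⟩
  induction i with
  | zero => exact h1
  | succ k ih =>
    rw [Function.iterate_succ_apply']
    exact ⟨dX_smooth ih.1, dX_compact ih.2⟩

lemma integrable_mul_test {ε b T : ℝ} (u : L2 ε b T) {ψ : ℝ × ℝ → ℝ} (h : ContDiff ℝ ∞ ψ)
    (hc : HasCompactSupport ψ) : Integrable (fun z => u z * ψ z) (muOm ε b T) := by
  have : IsFiniteMeasureOnCompacts (muOm ε b T) := by unfold muOm; infer_instance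
  exact MemLp.integrable_mul (p := 2) (q := 2) (Lp.memLp u) (h.continuous.memLp_of_hasCompactSupport hc)

lemma weak_zero {ε b T : ℝ} (i j : ℕ) : IsWeakDeriv ε b T i j 0 0 := by
  intro φ _
  have h0 : ∀ ψ : ℝ × ℝ → ℝ, ∫ z, (0 : L2 ε b T) z * ψ z ∂(muOm ε b T) = 0 := by
    intro ψ
    apply integral_eq_zero_of_ae
    filter_upwards [Lp.coeFn_zero ℝ 2 (muOm ε b T)] with z hz
    rw [hz]
    simp
  rw [h0, h0, mul_zero]

lemma weak_add {ε b T : ℝ} {i j : ℕ} {u w u' w' : L2 ε b T} (h : IsWeakDeriv ε b T i j u w)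
    (h' : IsWeakDeriv ε b T i j u' w') : IsWeakDeriv ε b T i j (u + u') (w + w') := by
  intro φ hφ
  have key : ∀ (a a' : L2 ε b T) (ψ : ℝ × ℝ → ℝ), ContDiff ℝ ∞ ψ → HasCompactSupport ψ →
      ∫ z, (a + a') z * ψ z ∂(muOm ε b T)
        = ∫ z, a z * ψ z ∂(muOm ε b T) + ∫ z, a' z * ψ z ∂(muOm ε b T) := by
    intro a a' ψ hs hc
    rw [← integral_add (integrable_mul_test a hs hc) (integrable_mul_test a' hs hc)]
    apply integral_congr_ae
    filter_upwards [Lp.coeFn_add a a'] with z hz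
    rw [hz, Pi.add_apply, add_mul]
  obtain ⟨g1, g2⟩ := iter_good hφ.1 hφ.2.1 i j
  rw [key u u' _ g1 g2, key w w' _ hφ.1 hφ.2.1, h φ hφ, h' φ hφ, mul_add]

lemma weak_smul {ε b T : ℝ} {i j : ℕ} {u w : L2 ε b T} (c : ℝ) (h : IsWeakDeriv ε b T i j u w) :
    IsWeakDeriv ε b T i j (c • u) (c • w) := by
  intro φ hφ
  have key : ∀ (a : L2 ε b T) (ψ : ℝ × ℝ → ℝ),
      ∫ z, (c • a) z * ψ z ∂(muOm ε b T) = c * ∫ z, a z * ψ z ∂(muOm ε b T) := by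
    intro a ψ
    rw [← integral_const_mul]
    apply integral_congr_ae
    filter_upwards [Lp.coeFn_smul c a] with z hz
    rw [hz, Pi.smul_apply, smul_eq_mul, mul_assoc]
  rw [key, key, h φ hφ]
  ring

/-- The Sobolev space `H⁴(Ω)`. A function `u ∈ H⁴(Ω)` is recorded together with all its weak
derivatives of order at most 4, as the family `(∂ₓⁱ ∂ₜʲ u)` in `L²(Ω)`; the component `(0, 0)`
is `u` and determines the others. The inherited scalar product is
`[u, v] = ∑_{i + j ≤ 4} ∫_Ω ∂ₓⁱ∂ₜʲ u · ∂ₓⁱ∂ₜʲ v`. -/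
def H4Sub (ε b T : ℝ) : Submodule ℝ (PiLp 2 (fun _ : Idx => L2 ε b T)) where
  carrier := {U | ∀ k : Idx, IsWeakDeriv ε b T (k.1.1 : ℕ) (k.1.2 : ℕ) (U idx0) (U k)}
  zero_mem' := fun _ => weak_zero _ _
  add_mem' := fun h h' k => weak_add (h k) (h' k)
  smul_mem' := fun c _ h k => weak_smul c (h k)

/-- `H⁴(Ω)` as a type, with norm and scalar product. -/
def H4 (ε b T : ℝ) : Type := ↥(H4Sub ε b T)

instance (ε b T : ℝ) : NormedAddCommGroup (H4 ε b T) :=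
  inferInstanceAs (NormedAddCommGroup ↥(H4Sub ε b T))

instance (ε b T : ℝ) : InnerProductSpace ℝ (H4 ε b T) :=
  inferInstanceAs (InnerProductSpace ℝ ↥(H4Sub ε b T))

/-- The weak derivative `∂ₓⁱ ∂ₜʲ u ∈ L²(Ω)` of `u ∈ H⁴(Ω)`. -/
def H4.D {ε b T : ℝ} (u : H4 ε b T) (i j : Fin 5) (h : (i : ℕ) + (j : ℕ) ≤ 4 := by decide) :
    L2 ε b T :=
  (Subtype.val (p := fun U => U ∈ H4Sub ε b T) u) ⟨(i, j), h⟩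

/-- `f` is a representative of `u` that is continuous on the closed rectangle; its values on the
closed rectangle, in particular on the boundary, are determined by `u`. -/
def IsContRep (ε b T : ℝ) (u : L2 ε b T) (f : ℝ × ℝ → ℝ) : Prop :=
  ContinuousOn f (OmBar ε b T) ∧ u =ᵐ[muOm ε b T] f

open Classical in
/-- The continuous representative of `u` (which exists for `u` and its derivatives of order at
most 2 if `u ∈ H⁴(Ω)`), used to give a meaning to values on the boundary. -/
def contRep {ε b T : ℝ} (u : L2 ε b T) : ℝ × ℝ → ℝ :=
  if h : ∃ f, IsContRep ε b T u f then h.choose else 0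

lemma contRep_add {ε b T : ℝ} {u v : L2 ε b T} {f g : ℝ × ℝ → ℝ} (hf : IsContRep ε b T u f)
    (hg : IsContRep ε b T v g) : IsContRep ε b T (u + v) (f + g) :=
  ⟨hf.1.add hg.1, (Lp.coeFn_add u v).trans (hf.2.add hg.2)⟩

lemma contRep_smul {ε b T : ℝ} {u : L2 ε b T} {f : ℝ × ℝ → ℝ} (c : ℝ)
    (hf : IsContRep ε b T u f) : IsContRep ε b T (c • u) (c • f) :=
  ⟨hf.1.const_smul c, (Lp.coeFn_smul c u).trans (hf.2.const_smul c)⟩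

/-- The subspace `H⁴₀(Ω)` of all `v ∈ H⁴(Ω)` with `v(ε, t) = vₓ(ε, t) = vₓ(b, t) = 0`. -/
def H40 (ε b T : ℝ) : Submodule ℝ (H4 ε b T) where
  carrier := {v | ∃ f fx : ℝ × ℝ → ℝ, IsContRep ε b T (v.D 0 0) f ∧ IsContRep ε b T (v.D 1 0) fx ∧
    ∀ t ∈ Ioo 0 T, f (ε, t) = 0 ∧ fx (ε, t) = 0 ∧ fx (b, t) = 0}
  zero_mem' := ⟨0, 0, ⟨continuousOn_const, Lp.coeFn_zero ℝ 2 (muOm ε b T)⟩,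
    ⟨continuousOn_const, Lp.coeFn_zero ℝ 2 (muOm ε b T)⟩, fun _ _ => ⟨rfl, rfl, rfl⟩⟩
  add_mem' := by
    rintro u v ⟨f, fx, h1, h2, h3⟩ ⟨g, gx, k1, k2, k3⟩
    refine ⟨f + g, fx + gx, contRep_add h1 k1, contRep_add h2 k2, fun t ht => ?_⟩
    obtain ⟨a1, a2, a3⟩ := h3 t ht
    obtain ⟨b1, b2, b3⟩ := k3 t ht
    simp [a1, a2, a3, b1, b2, b3]
  smul_mem' := by
    rintro c v ⟨f, fx, h1, h2, h3⟩
    refine ⟨c • f, c • fx, contRep_smul c h1, contRep_smul c h2, fun t ht => ?_⟩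
    obtain ⟨a1, a2, a3⟩ := h3 t ht
    simp [a1, a2, a3]

/-- The lower bound `1 / (2 b^{1/4})` for `q(x, 0)`. -/
def qLow (b : ℝ) : ℝ := 1 / (2 * b ^ (1 / 4 : ℝ))

/-- The set `B(R, g₀)`. -/
def admB (ε b T R : ℝ) (g₀ : ℝ → ℝ) : Set (H4 ε b T) :=
  {q | ‖q‖ < R ∧ ∃ f fx : ℝ × ℝ → ℝ,
    IsContRep ε b T (q.D 0 0) f ∧ IsContRep ε b T (q.D 1 0) fx ∧
    (∀ t ∈ Ioo 0 T, f (ε, t) = g₀ (t + ε) ∧ fx (ε, t) = 2 * deriv g₀ (t + ε) ∧ fx (b, t) = 0) ∧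
    ∀ x ∈ Icc ε b, qLow b ≤ f (x, 0) ∧ f (x, 0) ≤ 1 / 2}

/-- The truncation `q⁰(x, 0)` of `q(x, 0)` to the interval `[1 / (2 b^{1/4}), 1 / 2]`. -/
def qTrunc {ε b T : ℝ} (q : H4 ε b T) (x : ℝ) : ℝ :=
  max (qLow b) (min (1 / 2) (contRep (q.D 0 0) (x, 0)))

/-- The coefficient of `-q_{xt}` in `Aₙ`: it is `2` for `n = 0`, and it is built from the previous
minimizer `m (n - 1)` for `n ≥ 1`. -/
def coefA {ε b T : ℝ} (m : ℕ → H4 ε b T) : ℕ → ℝ → ℝ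
  | 0, _ => 2
  | k + 1, x => 1 / (2 * qTrunc (m k) x ^ 2)

/-- The operator `Aₙ(q) = q_{xx} - (coefficient) q_{xt}`. -/
def opA {ε b T : ℝ} (m : ℕ → H4 ε b T) (n : ℕ) (q : H4 ε b T) (z : ℝ × ℝ) : ℝ :=
  (q.D 2 0) z - coefA m n z.1 * (q.D 1 1) z

/-- The free term `Bₙ`: it is `0` for `n = 0`, and it is built from the previous minimizer
`m (n - 1)` for `n ≥ 1`. -/
def termB {ε b T : ℝ} (m : ℕ → H4 ε b T) : ℕ → ℝ × ℝ → ℝ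
  | 0, _ => 0
  | k + 1, z =>
    ((m k).D 0 1) z * (contRep ((m k).D 1 0) (z.1, 0) / (2 * qTrunc (m k) z.1 ^ 3))

/-- The Carleman weight `e^{2λφ} = e^{-2λ(x + αt)}`. -/
def weight (α lam : ℝ) (z : ℝ × ℝ) : ℝ := Real.exp (-2 * lam * (z.1 + α * z.2))

/-- The functional `J⁽ⁿ⁾_{λ,β}`; for `n ≥ 1` it depends on `m (n - 1)`. -/
def J {ε b T : ℝ} (α lam β : ℝ) (m : ℕ → H4 ε b T) (n : ℕ) (q : H4 ε b T) : ℝ :=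
  (∫ z in Om ε b T, (opA m n q z + termB m n z) ^ 2 * weight α lam z) + β * ‖q‖ ^ 2

/-- `p` is a minimizer of `F` on `S`. -/
def IsMinimizer {E : Type} (F : E → ℝ) (S : Set E) (p : E) : Prop :=
  p ∈ S ∧ ∀ q ∈ S, F p ≤ F q

/-- `m 0, …, m (n - 1)` are the minimizers, constructed one after the other, of the functionals
`J⁽⁰⁾, …, J⁽ⁿ⁻¹⁾` on the closure of `B(R, g₀)`. -/
def IsIteration {ε b T : ℝ} (R : ℝ) (g₀ : ℝ → ℝ) (α lam β : ℝ) (n : ℕ) (m : ℕ → H4 ε b T) : Prop :=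
  ∀ k < n, IsMinimizer (J α lam β m k) (closure (admB ε b T R g₀)) (m k)

/-- `g ∈ H⁴₀(Ω)` is the Fréchet derivative of `F` at `q` along `H⁴₀(Ω)`, identified with an
element of `H⁴₀(Ω)` through the scalar product of `H⁴(Ω)`:
`F(q + h) = F(q) + [g, h] + o(‖h‖)` for `h ∈ H⁴₀(Ω)`. -/
def IsFrechetDeriv {ε b T : ℝ} (F : H4 ε b T → ℝ) (q : H4 ε b T) (g : H40 ε b T) : Prop :=
  HasFDerivAt (fun h : H40 ε b T => F (q + (h : H4 ε b T))) (innerSL ℝ g) 0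

end Carleman1D

end

open Carleman1D

/-!
Up to `β‖·‖²` the functional is the square of the `L²`-norm of an affine map, so that
`J(q + h) - J(q) - J'(q)(h) = ∫_Ω (Aₙ h)² e^{2λφ} + β‖h‖²`, and everything except the lower bound of
part 3 holds for any Tikhonov functional on a Hilbert space.

The lower bound is a Carleman estimate for `Aₙ h = h_xx - c h_xt`. For `v = h_x` this is the
transport operator `v_x - c v_t`, which is estimated by multiplying `v e^{2λφ}` with it and
integrating by parts. The function `h` is recovered from `h_x` by a weighted Hardy inequality in
`x`, and so is `h_t` from `(h_x - c h_t)_x = Aₙ h - c' h_t`: this is why a truncated coefficient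
`c`, which is merely Lipschitz, is good enough. The boundary terms at `t = T` are at most a
multiple of `e^{-2λαT}‖h‖²` by the embedding `H⁴(Ω) ⊂ C²`, and `β ≥ 2e^{-λαT}` absorbs them. The
embedding comes from explicit kernels which represent a function by its weak derivatives.
-/

noncomputable section

open Filter

namespace Carleman1D

section StepKernel

variable {a b : ℝ}

/-- A smooth step which equals `0` on the first third of `[a, b]` and `1` on the last third. The
margins make the products with primitives of test functions compactly supported. -/
def smoothStep (a b x : ℝ) : ℝ := Real.smoothTransition (3 * (x - a) / (b - a) - 1)

/-- The kernel of the representation formula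
`u x = ∫ s in a..b, (smoothStep a b)' s * u s + ∫ s in a..b, stepKernel a b x s * u' s`. -/
def stepKernel (a b x s : ℝ) : ℝ := smoothStep a b s - (Ici x).indicator 1 s

/-- A common bound for the derivative of `smoothStep a b` and for `stepKernel a b`. -/
def stepBound (a b : ℝ) : ℝ := 1 + ⨆ s, |deriv (smoothStep a b) s|

lemma contDiff_smoothStep (a b : ℝ) : ContDiff ℝ ∞ (smoothStep a b) :=
  Real.smoothTransition.contDiff.comp (by fun_prop)

lemma continuous_deriv_smoothStep (a b : ℝ) : Continuous (deriv (smoothStep a b)) :=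
  (contDiff_smoothStep a b).continuous_deriv (by simp)

lemma smoothStep_eq_zero (hab : a < b) {x : ℝ} (hx : x ≤ a + (b - a) / 3) :
    smoothStep a b x = 0 := by
  apply Real.smoothTransition.zero_of_nonpos
  rw [sub_nonpos, div_le_one (sub_pos.2 hab)]
  linarith

lemma smoothStep_eq_one (hab : a < b) {x : ℝ} (hx : b - (b - a) / 3 ≤ x) :
    smoothStep a b x = 1 := by
  apply Real.smoothTransition.one_of_one_le
  rw [le_sub_iff_add_le, le_div_iff₀ (sub_pos.2 hab)]
  linarith

lemma hasCompactSupport_deriv_smoothStep (hab : a < b) :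
    HasCompactSupport (deriv (smoothStep a b)) := by
  refine HasCompactSupport.intro (isCompact_Icc (a := a) (b := b)) fun x hx => ?_
  rcases not_and_or.1 hx with h | h <;> push Not at h
  · have : smoothStep a b =ᶠ[nhds x] fun _ => 0 := by
      filter_upwards [Iio_mem_nhds h] with y hy
      exact smoothStep_eq_zero hab (by linarith [mem_Iio.1 hy])
    simp [this.deriv_eq]
  · have : smoothStep a b =ᶠ[nhds x] fun _ => 1 := by
      filter_upwards [Ioi_mem_nhds h] with y hy
      exact smoothStep_eq_one hab (by linarith [mem_Ioi.1 hy])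
    simp [this.deriv_eq]

lemma stepBound_pos (a b : ℝ) : 0 < stepBound a b :=
  add_pos_of_pos_of_nonneg one_pos (Real.iSup_nonneg fun _ => abs_nonneg _)

lemma abs_deriv_smoothStep_le (hab : a < b) (s : ℝ) :
    |deriv (smoothStep a b) s| ≤ stepBound a b := by
  obtain ⟨C, hC⟩ := (hasCompactSupport_deriv_smoothStep hab).exists_bound_of_continuous
    (continuous_deriv_smoothStep a b)
  exact (le_ciSup ⟨C, forall_mem_range.2 hC⟩ s).trans (le_add_of_nonneg_left zero_le_one)

lemma abs_stepKernel_le (a b x s : ℝ) : |stepKernel a b x s| ≤ stepBound a b := by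
  have h₀ : 0 ≤ smoothStep a b s := Real.smoothTransition.nonneg _
  have h₁ : smoothStep a b s ≤ 1 := Real.smoothTransition.le_one _
  have hbound : 1 ≤ stepBound a b :=
    le_add_of_nonneg_right (Real.iSup_nonneg fun _ => abs_nonneg _)
  by_cases h : x ≤ s <;> simp only [stepKernel, indicator, mem_Ici, h, if_true, if_false,
    Pi.one_apply, abs_le] <;> constructor <;> linarith

lemma measurable_stepKernel (a b : ℝ) : Measurable fun p : ℝ × ℝ => stepKernel a b p.1 p.2 := by
  have h : (fun p : ℝ × ℝ => stepKernel a b p.1 p.2) =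
      fun p => smoothStep a b p.2 - {p : ℝ × ℝ | p.1 ≤ p.2}.indicator 1 p := by
    ext p; simp [stepKernel, indicator]
  rw [h]
  exact ((contDiff_smoothStep a b).continuous.measurable.comp measurable_snd).sub
    (measurable_one.indicator (measurableSet_le measurable_fst measurable_snd))

lemma continuousAt_stepKernel {x s : ℝ} (h : s ≠ x) :
    ContinuousAt (fun y => stepKernel a b y s) x := by
  refine ContinuousAt.sub continuousAt_const ?_
  rcases lt_or_gt_of_ne h with h | h
  · refine (continuousAt_const (y := (0 : ℝ))).congr ?_
    filter_upwards [Ioi_mem_nhds h] with y hy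
    simp [mem_Ioi.1 hy]
  · refine (continuousAt_const (y := (1 : ℝ))).congr ?_
    filter_upwards [Iio_mem_nhds h] with y hy
    simp [(mem_Iio.1 hy).le]

end StepKernel

section Reconstruct

variable {a b : ℝ} {f f' : ℝ → ℝ}

/-- The value at `x` of the function on `(a, b)` that is reconstructed from `f` and its
derivative `f'` by the representation formula. -/
def reconstruct (a b : ℝ) (f f' : ℝ → ℝ) (x : ℝ) : ℝ :=
  ∫ s in Ioo a b, (deriv (smoothStep a b) s * f s + stepKernel a b x s * f' s)

lemma integrable_deriv_smoothStep_mul (hab : a < b) {μ : Measure ℝ} (hf : Integrable f μ) :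
    Integrable (fun s => deriv (smoothStep a b) s * f s) μ :=
  hf.bdd_mul (continuous_deriv_smoothStep a b).aestronglyMeasurable
    (Eventually.of_forall (abs_deriv_smoothStep_le hab))

lemma integrable_stepKernel_mul {μ : Measure ℝ} (hf' : Integrable f' μ) (x : ℝ) :
    Integrable (fun s => stepKernel a b x s * f' s) μ :=
  hf'.bdd_mul ((measurable_stepKernel a b).comp measurable_prodMk_left).aestronglyMeasurable
    (Eventually.of_forall (abs_stepKernel_le a b x))

lemma abs_reconstruct_integrand_le (hab : a < b) (x s y y' : ℝ) :
    |deriv (smoothStep a b) s * y + stepKernel a b x s * y'| ≤ stepBound a b * (|y| + |y'|) := by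
  refine (abs_add_le _ _).trans ?_
  rw [abs_mul, abs_mul, mul_add]
  gcongr
  exacts [abs_deriv_smoothStep_le hab s, abs_stepKernel_le a b x s]

lemma abs_reconstruct_le (hab : a < b) {F : ℝ → ℝ} (hF : IntegrableOn F (Ioo a b))
    (h : ∀ᵐ s ∂(volume.restrict (Ioo a b)), |f s| + |f' s| ≤ F s) (x : ℝ) :
    |reconstruct a b f f' x| ≤ stepBound a b * ∫ s in Ioo a b, F s := by
  rw [← integral_const_mul, ← Real.norm_eq_abs]
  refine norm_integral_le_of_norm_le (hF.const_mul _) ?_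
  filter_upwards [h] with s hs
  exact (abs_reconstruct_integrand_le hab x s _ _).trans
    (mul_le_mul_of_nonneg_left hs (stepBound_pos a b).le)

lemma reconstruct_congr_ae {g g' : ℝ → ℝ} (h : f =ᵐ[volume.restrict (Ioo a b)] g)
    (h' : f' =ᵐ[volume.restrict (Ioo a b)] g') (x : ℝ) :
    reconstruct a b f f' x = reconstruct a b g g' x := by
  refine integral_congr_ae ?_
  filter_upwards [h, h'] with s hs hs'
  rw [hs, hs']

lemma reconstruct_sub_left (hab : a < b) (hf : IntegrableOn f (Ioo a b))
    (hf' : IntegrableOn f' (Ioo a b)) {x : ℝ} (hx : x ∈ Icc a b) :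
    reconstruct a b f f' x - reconstruct a b f f' a = ∫ s in a..x, f' s := by
  have hi : ∀ y, Integrable (fun s => deriv (smoothStep a b) s * f s + stepKernel a b y s * f' s)
      (volume.restrict (Ioo a b)) := fun y =>
    (integrable_deriv_smoothStep_mul hab hf).add (integrable_stepKernel_mul hf' y)
  have hkernel : ∀ s ∈ Ioo a b, deriv (smoothStep a b) s * f s + stepKernel a b x s * f' s -
      (deriv (smoothStep a b) s * f s + stepKernel a b a s * f' s) = (Iio x).indicator f' s := by
    intro s hs
    by_cases h : x ≤ s <;>
      simp only [stepKernel, indicator, mem_Ici, mem_Iio, ← not_le, hs.1.le, h, not_true,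
        not_false_iff, if_true, if_false, Pi.one_apply] <;> ring
  rw [reconstruct, reconstruct, ← integral_sub (hi x) (hi a),
    setIntegral_congr_fun measurableSet_Ioo hkernel, setIntegral_indicator measurableSet_Iio,
    Ioo_inter_Iio, min_eq_right hx.2, intervalIntegral.integral_of_le hx.1,
    integral_Ioc_eq_integral_Ioo]

end Reconstruct

section WeakLineDeriv

/-- Test functions on `U`, with `U` not necessarily equal to the rectangle `Ω`. -/
structure IsTestOn (U : Set (ℝ × ℝ)) (φ : ℝ × ℝ → ℝ) : Prop where
  contDiff : ContDiff ℝ ∞ φ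
  hasCompactSupport : HasCompactSupport φ
  tsupport_subset : tsupport φ ⊆ U

/-- `v` is the weak derivative of `u` on `U` in the direction `e`. -/
def HasWeakLineDeriv (U : Set (ℝ × ℝ)) (e : ℝ × ℝ) (u v : ℝ × ℝ → ℝ) : Prop :=
  ∀ φ, IsTestOn U φ → ∫ z in U, u z * fderiv ℝ φ z e = -∫ z in U, v z * φ z

variable {U : Set (ℝ × ℝ)} {φ u v : ℝ × ℝ → ℝ} {e : ℝ × ℝ} {μ : Measure (ℝ × ℝ)}

lemma IsTestOn.eq_zero (hφ : IsTestOn U φ) {z : ℝ × ℝ} (hz : z ∉ U) : φ z = 0 :=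
  image_eq_zero_of_notMem_tsupport fun h => hz (hφ.tsupport_subset h)

lemma IsTestOn.fderiv_apply (hφ : IsTestOn U φ) (e : ℝ × ℝ) :
    IsTestOn U fun z => fderiv ℝ φ z e where
  contDiff := (hφ.contDiff.fderiv_right (m := ∞) (by simp)).clm_apply contDiff_const
  hasCompactSupport := hφ.hasCompactSupport.fderiv_apply (𝕜 := ℝ) e
  tsupport_subset := (tsupport_fderiv_apply_subset ℝ e).trans hφ.tsupport_subset

lemma IsTestOn.integrable_mul (hφ : IsTestOn U φ) (hu : Integrable u μ) :
    Integrable (fun z => u z * φ z) μ := by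
  obtain ⟨C, hC⟩ := hφ.hasCompactSupport.exists_bound_of_continuous hφ.contDiff.continuous
  exact hu.mul_bdd hφ.contDiff.continuous.aestronglyMeasurable (Eventually.of_forall hC)

lemma IsTestOn.comp_swap (hφ : IsTestOn U φ) : IsTestOn (Prod.swap ⁻¹' U) (φ ∘ Prod.swap) where
  contDiff := hφ.contDiff.comp (contDiff_snd.prodMk contDiff_fst)
  hasCompactSupport := hφ.hasCompactSupport.comp_homeomorph (Homeomorph.prodComm ℝ ℝ)
  tsupport_subset := (tsupport_comp_subset_preimage φ continuous_swap).trans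
    (preimage_mono hφ.tsupport_subset)

lemma HasWeakLineDeriv.congr_ae {u' v' : ℝ × ℝ → ℝ} (h : HasWeakLineDeriv U e u v)
    (hu : u =ᵐ[volume.restrict U] u') (hv : v =ᵐ[volume.restrict U] v') :
    HasWeakLineDeriv U e u' v' := fun φ hφ => by
  rw [← integral_congr_ae (hu.mono fun z hz => congrArg (· * fderiv ℝ φ z e) hz),
    ← integral_congr_ae (hv.mono fun z hz => congrArg (· * φ z) hz), h φ hφ]

lemma fderiv_comp_swap (φ : ℝ × ℝ → ℝ) (z e : ℝ × ℝ) :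
    fderiv ℝ (φ ∘ Prod.swap) z e = fderiv ℝ φ z.swap e.swap :=
  congrArg (fun L : ℝ × ℝ →L[ℝ] ℝ => L e)
    ((ContinuousLinearEquiv.prodComm ℝ ℝ ℝ).comp_right_fderiv (f := φ) (x := z))

lemma setIntegral_preimage_swap (U : Set (ℝ × ℝ)) (g : ℝ × ℝ → ℝ) :
    ∫ z in Prod.swap ⁻¹' U, g z.swap = ∫ z in U, g z :=
  (Measure.measurePreserving_swap (μ := volume) (ν := volume)).setIntegral_preimage_emb
    MeasurableEquiv.prodComm.measurableEmbedding g U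

lemma HasWeakLineDeriv.comp_swap (h : HasWeakLineDeriv U e u v) :
    HasWeakLineDeriv (Prod.swap ⁻¹' U) e.swap (u ∘ Prod.swap) (v ∘ Prod.swap) := by
  intro φ hφ
  have key := h (φ ∘ Prod.swap) hφ.comp_swap
  rw [← setIntegral_preimage_swap U, ← setIntegral_preimage_swap U] at key
  simpa [fderiv_comp_swap] using key

end WeakLineDeriv

section Primitive

variable {φ : ℝ × ℝ → ℝ}

/-- The primitive in `x` of a function which vanishes far to the left. -/
def primFst (φ : ℝ × ℝ → ℝ) (z : ℝ × ℝ) : ℝ := ∫ x in Iic z.1, φ (x, z.2)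

lemma hasCompactSupport_section_fst (hc : HasCompactSupport φ) (t : ℝ) :
    HasCompactSupport fun x => φ (x, t) :=
  HasCompactSupport.intro (hc.isCompact.image continuous_fst) fun x hx => by
    by_contra h
    exact hx ⟨(x, t), subset_tsupport _ h, rfl⟩

lemma integrable_section_fst (h : Continuous φ) (hc : HasCompactSupport φ) (t : ℝ) :
    Integrable fun x => φ (x, t) :=
  (by fun_prop : Continuous fun x => φ (x, t)).integrable_of_hasCompactSupport
    (hasCompactSupport_section_fst hc t)

lemma contDiff_primFst (h : ContDiff ℝ ∞ φ) (hc : HasCompactSupport φ) :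
    ContDiff ℝ ∞ (primFst φ) := by
  -- `primFst φ` is a convolution in `x` with the indicator of `[0, ∞)`.
  let H : ℝ → ℝ := (Ici 0).indicator 1
  have hconv := contDiffOn_convolution_right_with_param (𝕜 := ℝ) (μ := volume) (n := ⊤)
    (f := H) (ContinuousLinearMap.mul ℝ ℝ) (g := fun t x => φ (x, t)) (s := univ)
    (k := Prod.fst '' tsupport φ) isOpen_univ (hc.isCompact.image continuous_fst)
    (fun t x _ hx => by
      by_contra h
      exact hx ⟨(x, t), subset_tsupport _ h, rfl⟩)
    ((locallyIntegrable_const (1 : ℝ)).indicator measurableSet_Ici)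
    (h.comp (contDiff_snd.prodMk contDiff_fst)).contDiffOn
  rw [univ_prod_univ, contDiffOn_univ] at hconv
  have heq : primFst φ = fun z => (convolution H (fun x => φ (x, z.2))
      (ContinuousLinearMap.mul ℝ ℝ) volume) z.1 := by
    ext z
    simp only [primFst, convolution, ContinuousLinearMap.mul_apply']
    rw [← integral_sub_left_eq_self _ volume z.1, ← integral_indicator measurableSet_Iic]
    congr 1
    ext x
    by_cases hx : x ≤ z.1 <;> simp [H, indicator, hx]
  rw [heq]
  exact hconv.comp (contDiff_snd.prodMk contDiff_fst)

lemma hasDerivAt_primFst (h : Continuous φ) (hc : HasCompactSupport φ) (s t : ℝ) :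
    HasDerivAt (fun s => primFst φ (s, t)) (φ (s, t)) s := by
  have hi := integrable_section_fst h hc t
  have heq : (fun s => primFst φ (s, t)) =
      fun s => primFst φ (0, t) + ∫ x in (0 : ℝ)..s, φ (x, t) := by
    ext s
    simp only [primFst]
    rw [← intervalIntegral.integral_Iic_sub_Iic hi.integrableOn hi.integrableOn]
    ring
  have hcs : Continuous fun x => φ (x, t) := by fun_prop
  rw [heq]
  exact (intervalIntegral.integral_hasDerivAt_right (hcs.intervalIntegrable _ _)
    (hcs.stronglyMeasurableAtFilter _ _) hcs.continuousAt).const_add _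

lemma dX_eq_of_hasDerivAt {s t d : ℝ} (h : DifferentiableAt ℝ φ (s, t))
    (hd : HasDerivAt (fun s => φ (s, t)) d s) : dX φ (s, t) = d :=
  (h.hasFDerivAt.comp_hasDerivAt s
    ((hasDerivAt_id s).prodMk (hasDerivAt_const s t))).unique hd

variable {a b c d : ℝ} {K : Set ℝ}

lemma primFst_right {V : Set ℝ} (hφ : IsTestOn (Ioo a b ×ˢ V) φ) (t : ℝ) :
    primFst φ (b, t) = ∫ x in Ioo a b, φ (x, t) := by
  have hz : ∀ x ∉ Ioo a b, φ (x, t) = 0 := fun x hx => hφ.eq_zero fun h => hx h.1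
  rw [primFst, setIntegral_eq_integral_of_forall_compl_eq_zero,
    setIntegral_eq_integral_of_forall_compl_eq_zero hz]
  exact fun x hx => hz x fun h => hx h.2.le

/-- The transpose of the representation formula for `∂ₓ`, applied to a test function. -/
def kernelTranspose (a b : ℝ) (φ : ℝ × ℝ → ℝ) (z : ℝ × ℝ) : ℝ :=
  smoothStep a b z.1 * primFst φ (b, z.2) - primFst φ z

lemma contDiff_kernelTranspose (h : ContDiff ℝ ∞ φ) (hc : HasCompactSupport φ) :
    ContDiff ℝ ∞ (kernelTranspose a b φ) :=
  (((contDiff_smoothStep a b).comp contDiff_fst).mul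
    ((contDiff_primFst h hc).comp (contDiff_const.prodMk contDiff_snd))).sub
    (contDiff_primFst h hc)

lemma kernelTranspose_eq_zero {A B : ℝ} (hab : a < b) (hA : A ≤ a + (b - a) / 3)
    (hB : b - (b - a) / 3 ≤ B) (hBb : B ≤ b) (hφ : ∀ z ∉ Icc A B ×ˢ K, φ z = 0) :
    ∀ z ∉ Icc A B ×ˢ K, kernelTranspose a b φ z = 0 := by
  rintro ⟨s, t⟩ hz
  by_cases ht : t ∈ K
  · rcases not_and_or.1 fun h => hz ⟨h, ht⟩ with hs | hs <;> push Not at hs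
    · have hprim : primFst φ (s, t) = 0 :=
        setIntegral_eq_zero_of_forall_eq_zero fun x hx =>
          hφ _ fun h => (h.1.1.trans hx).not_gt hs
      simp [kernelTranspose, hprim, smoothStep_eq_zero hab (hs.le.trans hA)]
    · have hprim : ∀ y, B ≤ y → primFst φ (y, t) = ∫ x, φ (x, t) := fun y hy =>
        setIntegral_eq_integral_of_forall_compl_eq_zero fun x hx =>
          hφ _ fun h => hx (h.1.2.trans hy)
      simp [kernelTranspose, hprim s hs.le, hprim b hBb,
        smoothStep_eq_one hab (hB.trans hs.le)]
  · have hzero : ∀ x, φ (x, t) = 0 := fun x => hφ _ fun h => ht h.2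
    simp [kernelTranspose, primFst, hzero]

lemma exists_thirds_subset_Icc (hK : IsCompact K) (hKs : K ⊆ Ioo a b) (hab : a < b) :
    ∃ A B, a < A ∧ A ≤ a + (b - a) / 3 ∧ b - (b - a) / 3 ≤ B ∧ B < b ∧ K ⊆ Icc A B := by
  rcases K.eq_empty_or_nonempty with rfl | hne
  · exact ⟨a + (b - a) / 3, b - (b - a) / 3, by linarith, le_rfl, le_rfl, by linarith, by simp⟩
  · obtain ⟨l, hl, hl'⟩ := hK.exists_isLeast hne
    obtain ⟨u, hu, hu'⟩ := hK.exists_isGreatest hne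
    exact ⟨min l (a + (b - a) / 3), max u (b - (b - a) / 3),
      lt_min (hKs hl).1 (by linarith), min_le_right _ _, le_max_right _ _,
      max_lt (hKs hu).2 (by linarith),
      fun x hx => ⟨(min_le_left _ _).trans (hl' hx), (hu' hx).trans (le_max_left _ _)⟩⟩

lemma IsTestOn.kernelTranspose {V : Set ℝ} (hab : a < b) (hφ : IsTestOn (Ioo a b ×ˢ V) φ) :
    IsTestOn (Ioo a b ×ˢ V) (kernelTranspose a b φ) := by
  have hfst : Prod.fst '' tsupport φ ⊆ Ioo a b :=
    (image_mono hφ.tsupport_subset).trans (fst_image_prod_subset _ _)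
  have hsnd : Prod.snd '' tsupport φ ⊆ V :=
    (image_mono hφ.tsupport_subset).trans (snd_image_prod_subset _ _)
  obtain ⟨A, B, haA, hA, hB, hBb, hAB⟩ :=
    exists_thirds_subset_Icc (hφ.hasCompactSupport.isCompact.image continuous_fst) hfst hab
  have hK : IsCompact (Icc A B ×ˢ (Prod.snd '' tsupport φ)) :=
    isCompact_Icc.prod (hφ.hasCompactSupport.isCompact.image continuous_snd)
  have hzero := kernelTranspose_eq_zero (φ := φ) hab hA hB hBb.le
    (K := Prod.snd '' tsupport φ) fun z hz => image_eq_zero_of_notMem_tsupport fun h =>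
      hz ⟨hAB (mem_image_of_mem _ h), mem_image_of_mem _ h⟩
  refine ⟨contDiff_kernelTranspose hφ.contDiff hφ.hasCompactSupport,
    HasCompactSupport.intro hK hzero, ?_⟩
  refine (closure_minimal (fun z hz => not_imp_comm.1 (hzero z) hz) hK.isClosed).trans ?_
  exact prod_mono (Icc_subset_Ioo haA hBb) hsnd

lemma dX_kernelTranspose (h : ContDiff ℝ ∞ φ) (hc : HasCompactSupport φ) (z : ℝ × ℝ) :
    dX (kernelTranspose a b φ) z =
      deriv (smoothStep a b) z.1 * primFst φ (b, z.2) - φ z := by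
  have hstep : HasDerivAt (smoothStep a b) (deriv (smoothStep a b) z.1) z.1 :=
    ((contDiff_smoothStep a b).differentiable (by simp) _).hasDerivAt
  exact dX_eq_of_hasDerivAt ((contDiff_kernelTranspose h hc).differentiable (by simp) _)
    ((hstep.mul_const (primFst φ (b, z.2))).fun_sub (hasDerivAt_primFst h.continuous hc z.1 z.2))

lemma kernelTranspose_eq_integral {V : Set ℝ} (hφ : IsTestOn (Ioo a b ×ˢ V) φ) (s t : ℝ) :
    kernelTranspose a b φ (s, t) = ∫ x in Ioo a b, stepKernel a b x s * φ (x, t) := by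
  have hi := integrable_section_fst hφ.contDiff.continuous hφ.hasCompactSupport t
  have hkernel : ∀ x, stepKernel a b x s * φ (x, t) =
      smoothStep a b s * φ (x, t) - (Iic s).indicator (fun x => φ (x, t)) x := by
    intro x
    by_cases hx : x ≤ s <;> simp [stepKernel, indicator, hx, sub_mul]
  have hprim : ∫ x in Ioo a b, (Iic s).indicator (fun x => φ (x, t)) x = primFst φ (s, t) := by
    rw [primFst, ← integral_indicator measurableSet_Iic]
    refine setIntegral_eq_integral_of_forall_compl_eq_zero fun x hx => ?_
    have hzero : φ (x, t) = 0 := hφ.eq_zero fun h => hx h.1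
    simp [indicator, hzero]
  simp_rw [kernelTranspose, primFst_right hφ, hkernel]
  rw [integral_sub (hi.integrableOn.const_mul _)
    ((hi.indicator measurableSet_Iic).integrableOn), integral_const_mul, hprim]

end Primitive

section ReconstructFst

/-- Lebesgue measure on `(a, b)`. -/
abbrev volIoo (a b : ℝ) : Measure ℝ := volume.restrict (Ioo a b)

lemma volIoo_prod_volIoo (a b c d : ℝ) :
    (volIoo a b).prod (volIoo c d) = volume.restrict (Ioo a b ×ˢ Ioo c d) := by
  rw [Measure.prod_restrict, Measure.volume_eq_prod]

/-- Reconstruction of a function of `(x, t)` from itself and its derivative in `x`. -/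
def reconstructFst (a b : ℝ) (u v : ℝ × ℝ → ℝ) (z : ℝ × ℝ) : ℝ :=
  reconstruct a b (fun s => u (s, z.2)) (fun s => v (s, z.2)) z.1

/-- Reconstruction of a function of `(x, t)` from itself and its derivative in `t`. -/
def reconstructSnd (c d : ℝ) (u v : ℝ × ℝ → ℝ) (z : ℝ × ℝ) : ℝ :=
  reconstruct c d (fun r => u (z.1, r)) (fun r => v (z.1, r)) z.2

variable {a b c d : ℝ} {u v φ : ℝ × ℝ → ℝ}

lemma integrable_reconstructFst_integrand (hab : a < b)
    (hu : Integrable u ((volIoo a b).prod (volIoo c d)))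
    (hv : Integrable v ((volIoo a b).prod (volIoo c d))) :
    Integrable (fun p : ℝ × ℝ × ℝ => deriv (smoothStep a b) p.2.2 * u p.2.swap +
      stepKernel a b p.1 p.2.2 * v p.2.swap)
      ((volIoo a b).prod ((volIoo c d).prod (volIoo a b))) := by
  refine ((hu.swap.comp_snd (volIoo a b)).bdd_mul (c := stepBound a b) ?_ ?_).add
    ((hv.swap.comp_snd (volIoo a b)).bdd_mul (c := stepBound a b) ?_ ?_)
  · exact ((continuous_deriv_smoothStep a b).comp (by fun_prop)).aestronglyMeasurable
  · exact Eventually.of_forall fun p => abs_deriv_smoothStep_le hab p.2.2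
  · exact ((measurable_stepKernel a b).comp (f := fun p : ℝ × ℝ × ℝ => (p.1, p.2.2))
      (by fun_prop)).aestronglyMeasurable
  · exact Eventually.of_forall fun p => abs_stepKernel_le a b p.1 p.2.2

lemma integrable_reconstructFst (hab : a < b)
    (hu : Integrable u ((volIoo a b).prod (volIoo c d)))
    (hv : Integrable v ((volIoo a b).prod (volIoo c d))) :
    Integrable (reconstructFst a b u v) ((volIoo a b).prod (volIoo c d)) :=
  have assoc := measurePreserving_prodAssoc (volIoo a b) (volIoo c d) (volIoo a b)
  (assoc.integrable_comp_of_integrable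
    (integrable_reconstructFst_integrand hab hu hv)).integral_prod_left

lemma integral_kernel_mul {V : Set ℝ} (hφ : IsTestOn (Ioo a b ×ˢ V) φ) (p q s t : ℝ) :
    ∫ x in Ioo a b, (p + stepKernel a b x s * q) * φ (x, t) =
      p * primFst φ (b, t) + q * kernelTranspose a b φ (s, t) := by
  have hsection : Integrable (fun x => φ (x, t)) (volIoo a b) :=
    (integrable_section_fst hφ.contDiff.continuous hφ.hasCompactSupport t).integrableOn
  have hker : Integrable (fun x => stepKernel a b x s * φ (x, t)) (volIoo a b) :=
    hsection.bdd_mul ((measurable_stepKernel a b).comp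
      measurable_prodMk_right).aestronglyMeasurable
      (Eventually.of_forall fun x => abs_stepKernel_le a b x s)
  have hsplit : ∀ x, (p + stepKernel a b x s * q) * φ (x, t) =
      p * φ (x, t) + q * (stepKernel a b x s * φ (x, t)) := fun x => by ring
  simp only [hsplit]
  rw [integral_add (hsection.const_mul _) (hker.const_mul _), integral_const_mul,
    integral_const_mul, ← primFst_right hφ, ← kernelTranspose_eq_integral hφ]

lemma integral_reconstructFst_mul (hab : a < b)
    (hu : Integrable u ((volIoo a b).prod (volIoo c d)))
    (hv : Integrable v ((volIoo a b).prod (volIoo c d))) (hφ : IsTestOn (Ioo a b ×ˢ Ioo c d) φ) :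
    ∫ z, reconstructFst a b u v z * φ z ∂((volIoo a b).prod (volIoo c d)) =
      ∫ z, (u z * (deriv (smoothStep a b) z.1 * primFst φ (b, z.2)) +
        v z * kernelTranspose a b φ z) ∂((volIoo a b).prod (volIoo c d)) := by
  set F : ℝ × ℝ × ℝ → ℝ := fun p => (deriv (smoothStep a b) p.2.2 * u p.2.swap +
    stepKernel a b p.1 p.2.2 * v p.2.swap) * φ (p.1, p.2.1) with hF
  have hassoc := measurePreserving_prodAssoc (volIoo a b) (volIoo c d) (volIoo a b)
  obtain ⟨C, hC⟩ := hφ.hasCompactSupport.exists_bound_of_continuous hφ.contDiff.continuous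
  have hFi : Integrable F ((volIoo a b).prod ((volIoo c d).prod (volIoo a b))) :=
    (integrable_reconstructFst_integrand hab hu hv).mul_bdd
      (hφ.contDiff.continuous.comp (by fun_prop)).aestronglyMeasurable
      (Eventually.of_forall fun p => hC _)
  calc ∫ z, reconstructFst a b u v z * φ z ∂((volIoo a b).prod (volIoo c d))
      = ∫ z : ℝ × ℝ, ∫ s, F (z.1, z.2, s) ∂(volIoo a b) ∂((volIoo a b).prod (volIoo c d)) := by
        simp only [hF, integral_mul_const]; rfl
    _ = ∫ p, F p ∂((volIoo a b).prod ((volIoo c d).prod (volIoo a b))) := by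
        exact (integral_prod _ (hassoc.integrable_comp_of_integrable hFi)).symm.trans
          (hassoc.integral_comp' F)
    _ = ∫ y : ℝ × ℝ, ∫ x, F (x, y) ∂(volIoo a b) ∂((volIoo c d).prod (volIoo a b)) :=
        integral_prod_symm F hFi
    _ = ∫ y : ℝ × ℝ, (u y.swap * (deriv (smoothStep a b) y.2 * primFst φ (b, y.1)) +
        v y.swap * kernelTranspose a b φ y.swap) ∂((volIoo c d).prod (volIoo a b)) := by
        simp only [hF, integral_kernel_mul hφ, mul_comm (deriv _ _), mul_assoc, Prod.swap]
    _ = _ := integral_prod_swap (fun z : ℝ × ℝ => u z * (deriv (smoothStep a b) z.1 *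
        primFst φ (b, z.2)) + v z * kernelTranspose a b φ z)

lemma HasWeakLineDeriv.integral_reconstructFst_mul (hab : a < b)
    (hu : Integrable u ((volIoo a b).prod (volIoo c d)))
    (hv : Integrable v ((volIoo a b).prod (volIoo c d)))
    (h : HasWeakLineDeriv (Ioo a b ×ˢ Ioo c d) (1, 0) u v)
    (hφ : IsTestOn (Ioo a b ×ˢ Ioo c d) φ) :
    ∫ z, reconstructFst a b u v z * φ z ∂((volIoo a b).prod (volIoo c d)) =
      ∫ z, u z * φ z ∂((volIoo a b).prod (volIoo c d)) := by
  have hψ := hφ.kernelTranspose hab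
  have hderiv : ∀ z, u z * (deriv (smoothStep a b) z.1 * primFst φ (b, z.2)) +
      v z * kernelTranspose a b φ z =
      u z * dX (kernelTranspose a b φ) z + u z * φ z + v z * kernelTranspose a b φ z := fun z => by
    rw [dX_kernelTranspose hφ.contDiff hφ.hasCompactSupport]; ring
  have hparts := h _ hψ
  rw [← volIoo_prod_volIoo] at hparts
  have hi : Integrable (fun z => u z * dX (kernelTranspose a b φ) z)
      ((volIoo a b).prod (volIoo c d)) := (hψ.fderiv_apply (1, 0)).integrable_mul hu
  rw [Carleman1D.integral_reconstructFst_mul hab hu hv hφ]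
  simp_rw [hderiv]
  rw [integral_add (hi.fun_add (hφ.integrable_mul hu)) (hψ.integrable_mul hv),
    integral_add hi (hφ.integrable_mul hu)]
  simp only [dX, hparts]
  ring

lemma HasWeakLineDeriv.ae_eq_reconstructFst (hab : a < b)
    (hu : Integrable u ((volIoo a b).prod (volIoo c d)))
    (hv : Integrable v ((volIoo a b).prod (volIoo c d)))
    (h : HasWeakLineDeriv (Ioo a b ×ˢ Ioo c d) (1, 0) u v) :
    u =ᵐ[(volIoo a b).prod (volIoo c d)] reconstructFst a b u v := by
  have hopen : IsOpen (Ioo a b ×ˢ Ioo c d : Set (ℝ × ℝ)) := isOpen_Ioo.prod isOpen_Ioo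
  have hrec := integrable_reconstructFst hab hu hv
  have hloc : IntegrableOn (u - reconstructFst a b u v) (Ioo a b ×ˢ Ioo c d) := by
    rw [IntegrableOn, ← volIoo_prod_volIoo]
    exact hu.sub hrec
  have hzero := hopen.ae_eq_zero_of_integral_contDiff_smul_eq_zero hloc.locallyIntegrableOn
    (μ := volume) fun φ hsmooth hcomp hsupp => by
      have hφ : IsTestOn (Ioo a b ×ˢ Ioo c d) φ := ⟨hsmooth, hcomp, hsupp⟩
      have eq_setIntegral := setIntegral_eq_integral_of_forall_compl_eq_zero (μ := volume)
        (f := fun z => φ z • (u - reconstructFst a b u v) z)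
        fun z (hz : z ∉ Ioo a b ×ˢ Ioo c d) => by simp [hφ.eq_zero hz]
      rw [← eq_setIntegral, ← volIoo_prod_volIoo]
      simp_rw [Pi.sub_apply, smul_eq_mul, mul_sub, mul_comm (φ _)]
      rw [integral_sub (hφ.integrable_mul hu) (hφ.integrable_mul hrec),
        h.integral_reconstructFst_mul hab hu hv hφ, sub_self]
  rw [volIoo_prod_volIoo, EventuallyEq, ae_restrict_iff' hopen.measurableSet]
  filter_upwards [hzero] with z hz hzU
  exact sub_eq_zero.1 (hz hzU)

lemma HasWeakLineDeriv.ae_eq_reconstructSnd (hcd : c < d)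
    (hu : Integrable u ((volIoo a b).prod (volIoo c d)))
    (hv : Integrable v ((volIoo a b).prod (volIoo c d)))
    (h : HasWeakLineDeriv (Ioo a b ×ˢ Ioo c d) (0, 1) u v) :
    u =ᵐ[(volIoo a b).prod (volIoo c d)] reconstructSnd c d u v := by
  have hswap := h.comp_swap
  rw [preimage_swap_prod] at hswap
  filter_upwards [Measure.measurePreserving_swap.quasiMeasurePreserving.ae
    (hswap.ae_eq_reconstructFst hcd hu.swap hv.swap)] with z hz
  exact hz

lemma ae_prod_swap {p : ℝ × ℝ → Prop} {μ ν : Measure ℝ} [SFinite μ] [SFinite ν]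
    (h : ∀ᵐ z ∂(μ.prod ν), p z) : ∀ᵐ t ∂ν, ∀ᵐ s ∂μ, p (s, t) :=
  Measure.ae_ae_of_ae_prod (Measure.measurePreserving_swap.quasiMeasurePreserving.ae h)

lemma reconstructFst_congr_ae {u' v' : ℝ × ℝ → ℝ}
    (hu : u =ᵐ[(volIoo a b).prod (volIoo c d)] u')
    (hv : v =ᵐ[(volIoo a b).prod (volIoo c d)] v') :
    reconstructFst a b u v =ᵐ[(volIoo a b).prod (volIoo c d)] reconstructFst a b u' v' := by
  filter_upwards [Measure.quasiMeasurePreserving_snd.ae (ae_prod_swap hu),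
    Measure.quasiMeasurePreserving_snd.ae (ae_prod_swap hv)] with z hz hz'
  exact reconstruct_congr_ae hz hz' _

end ReconstructFst

section Caratheodory

/-- A function of `(s, t)` that is measurable in `s`, continuous in `t`, and bounded uniformly in
`t` by an integrable function `U` of `s`: what dominated convergence in `s` asks for. -/
structure DominatedCaratheodory (a b : ℝ) (u : ℝ × ℝ → ℝ) (U : ℝ → ℝ) : Prop where
  aestronglyMeasurable : ∀ t, AEStronglyMeasurable (fun s => u (s, t)) (volIoo a b)
  continuous : ∀ᵐ s ∂(volIoo a b), Continuous fun t => u (s, t)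
  integrable_bound : Integrable U (volIoo a b)
  abs_le : ∀ᵐ s ∂(volIoo a b), ∀ t, |u (s, t)| ≤ U s

variable {a b c d : ℝ} {u v : ℝ × ℝ → ℝ} {U V : ℝ → ℝ}

lemma dominatedCaratheodory_of_continuous (hu : Continuous u) {C : ℝ} (hC : ∀ z, |u z| ≤ C) :
    DominatedCaratheodory a b u fun _ => C where
  aestronglyMeasurable _ := (by fun_prop : Continuous _).aestronglyMeasurable
  continuous := Eventually.of_forall fun _ => by fun_prop
  integrable_bound := integrable_const C
  abs_le := Eventually.of_forall fun _ _ => hC _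

lemma dominatedCaratheodory_fst {f : ℝ → ℝ} (hf : Integrable f (volIoo a b)) :
    DominatedCaratheodory a b (fun z => f z.1) fun s => |f s| where
  aestronglyMeasurable _ := hf.aestronglyMeasurable
  continuous := Eventually.of_forall fun _ => by simpa using continuous_const
  integrable_bound := hf.abs
  abs_le := Eventually.of_forall fun _ _ => le_rfl

lemma continuous_reconstructFst (hab : a < b) (hu : DominatedCaratheodory a b u U)
    (hv : DominatedCaratheodory a b v V) : Continuous (reconstructFst a b u v) := by
  refine continuous_iff_continuousAt.2 fun z => continuousAt_of_dominated
    (bound := fun s => stepBound a b * (U s + V s)) (Eventually.of_forall fun y => ?_)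
    (Eventually.of_forall fun y => ?_)
    ((hu.integrable_bound.add hv.integrable_bound).const_mul _) ?_
  · exact ((continuous_deriv_smoothStep a b).aestronglyMeasurable.mul
      (hu.aestronglyMeasurable y.2)).add (((measurable_stepKernel a b).comp
        measurable_prodMk_left).aestronglyMeasurable.mul (hv.aestronglyMeasurable y.2))
  · filter_upwards [hu.abs_le, hv.abs_le] with s hus hvs
    exact (abs_reconstruct_integrand_le hab _ _ _ _).trans
      (mul_le_mul_of_nonneg_left (add_le_add (hus _) (hvs _)) (stepBound_pos a b).le)
  · filter_upwards [hu.continuous, hv.continuous, Measure.ae_ne (volIoo a b) z.1]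
      with s hus hvs hs
    have hker : ContinuousAt (fun y : ℝ × ℝ => stepKernel a b y.1 s) z :=
      ContinuousAt.comp' (f := Prod.fst) (continuousAt_stepKernel hs) continuousAt_fst
    exact (continuousAt_const.mul (hus.comp continuous_snd).continuousAt).add
      (hker.mul (hvs.comp continuous_snd).continuousAt)

lemma abs_reconstructFst_le (hab : a < b) (hu : DominatedCaratheodory a b u U)
    (hv : DominatedCaratheodory a b v V) (z : ℝ × ℝ) :
    |reconstructFst a b u v z| ≤ stepBound a b * ∫ s, (U s + V s) ∂(volIoo a b) :=
  abs_reconstruct_le hab (hu.integrable_bound.add hv.integrable_bound)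
    (by filter_upwards [hu.abs_le, hv.abs_le] with s hus hvs using add_le_add (hus _) (hvs _)) _

lemma continuous_reconstruct (hab : a < b) {f f' : ℝ → ℝ} (hf : Integrable f (volIoo a b))
    (hf' : Integrable f' (volIoo a b)) : Continuous (reconstruct a b f f') :=
  (continuous_reconstructFst hab (dominatedCaratheodory_fst hf)
    (dominatedCaratheodory_fst hf')).comp (by fun_prop : Continuous fun x : ℝ => (x, (0 : ℝ)))

lemma dominatedCaratheodory_reconstructSnd (hcd : c < d)
    (hu : Integrable u ((volIoo a b).prod (volIoo c d)))
    (hv : Integrable v ((volIoo a b).prod (volIoo c d))) :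
    DominatedCaratheodory a b (reconstructSnd c d u v)
      fun s => stepBound c d * ∫ r, (|u (s, r)| + |v (s, r)|) ∂(volIoo c d) where
  aestronglyMeasurable t := by
    have hi : Integrable (fun z : ℝ × ℝ => deriv (smoothStep c d) z.2 * u z +
        stepKernel c d t z.2 * v z) ((volIoo a b).prod (volIoo c d)) :=
      (hu.bdd_mul ((continuous_deriv_smoothStep c d).comp continuous_snd).aestronglyMeasurable
        (Eventually.of_forall fun z => abs_deriv_smoothStep_le hcd z.2)).add
      (hv.bdd_mul ((measurable_stepKernel c d).comp
        (measurable_const.prodMk measurable_snd)).aestronglyMeasurable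
        (Eventually.of_forall fun z => abs_stepKernel_le c d t z.2))
    exact hi.integral_prod_left.aestronglyMeasurable
  continuous := by
    filter_upwards [hu.prod_right_ae, hv.prod_right_ae] with s hus hvs
    exact continuous_reconstruct hcd hus hvs
  integrable_bound := (hu.abs.add hv.abs).integral_prod_left.const_mul _
  abs_le := by
    filter_upwards [hu.prod_right_ae, hv.prod_right_ae] with s hus hvs t
    exact abs_reconstruct_le hcd (hus.abs.add hvs.abs) (Eventually.of_forall fun _ => le_rfl) t

end Caratheodory

section ReconstructRect

variable {a b c d : ℝ} {u ux ut uxt : ℝ × ℝ → ℝ}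

/-- The continuous function on the plane that is reconstructed from `u`, `uₓ`, `uₜ`, `uₓₜ` on the
rectangle `(a, b) × (c, d)`. -/
def reconstructRect (a b c d : ℝ) (u ux ut uxt : ℝ × ℝ → ℝ) : ℝ × ℝ → ℝ :=
  reconstructFst a b (reconstructSnd c d u ut) (reconstructSnd c d ux uxt)

lemma continuous_reconstructRect (hab : a < b) (hcd : c < d)
    (hu : Integrable u ((volIoo a b).prod (volIoo c d)))
    (hux : Integrable ux ((volIoo a b).prod (volIoo c d)))
    (hut : Integrable ut ((volIoo a b).prod (volIoo c d)))
    (huxt : Integrable uxt ((volIoo a b).prod (volIoo c d))) :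
    Continuous (reconstructRect a b c d u ux ut uxt) :=
  continuous_reconstructFst hab (dominatedCaratheodory_reconstructSnd hcd hu hut)
    (dominatedCaratheodory_reconstructSnd hcd hux huxt)

lemma abs_reconstructRect_le (hab : a < b) (hcd : c < d)
    (hu : Integrable u ((volIoo a b).prod (volIoo c d)))
    (hux : Integrable ux ((volIoo a b).prod (volIoo c d)))
    (hut : Integrable ut ((volIoo a b).prod (volIoo c d)))
    (huxt : Integrable uxt ((volIoo a b).prod (volIoo c d))) (z : ℝ × ℝ) :
    |reconstructRect a b c d u ux ut uxt z| ≤ stepBound a b * stepBound c d *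
      ∫ w, (|u w| + |ut w| + (|ux w| + |uxt w|)) ∂((volIoo a b).prod (volIoo c d)) := by
  refine (abs_reconstructFst_le hab (dominatedCaratheodory_reconstructSnd hcd hu hut)
    (dominatedCaratheodory_reconstructSnd hcd hux huxt) z).trans_eq ?_
  have hi := hu.abs.fun_add hut.abs
  have hix := hux.abs.fun_add huxt.abs
  rw [integral_add (hi.integral_prod_left.const_mul _) (hix.integral_prod_left.const_mul _),
    integral_const_mul, integral_const_mul, integral_add hi hix, integral_prod _ hi,
    integral_prod _ hix]
  ring

lemma ae_eq_reconstructRect (hab : a < b) (hcd : c < d)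
    (hu : Integrable u ((volIoo a b).prod (volIoo c d)))
    (hux : Integrable ux ((volIoo a b).prod (volIoo c d)))
    (hut : Integrable ut ((volIoo a b).prod (volIoo c d)))
    (huxt : Integrable uxt ((volIoo a b).prod (volIoo c d)))
    (hx : HasWeakLineDeriv (Ioo a b ×ˢ Ioo c d) (1, 0) u ux)
    (ht : HasWeakLineDeriv (Ioo a b ×ˢ Ioo c d) (0, 1) u ut)
    (hxt : HasWeakLineDeriv (Ioo a b ×ˢ Ioo c d) (0, 1) ux uxt) :
    u =ᵐ[(volIoo a b).prod (volIoo c d)] reconstructRect a b c d u ux ut uxt :=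
  (hx.ae_eq_reconstructFst hab hu hux).trans (reconstructFst_congr_ae
    (ht.ae_eq_reconstructSnd hcd hu hut) (hxt.ae_eq_reconstructSnd hcd hux huxt))

end ReconstructRect

section FundamentalTheorem

variable {a b c d : ℝ} {f g : ℝ × ℝ → ℝ}

lemma eqOn_Icc_prod_of_ae_eq (hab : a < b) (hcd : c < d)
    (hf : ContinuousOn f (Icc a b ×ˢ Icc c d)) (hg : ContinuousOn g (Icc a b ×ˢ Icc c d))
    (h : f =ᵐ[volume.restrict (Ioo a b ×ˢ Ioo c d)] g) : EqOn f g (Icc a b ×ˢ Icc c d) := by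
  have hsub : Ioo a b ×ˢ Ioo c d ⊆ Icc a b ×ˢ Icc c d :=
    prod_mono Ioo_subset_Icc_self Ioo_subset_Icc_self
  refine (Measure.eqOn_open_of_ae_eq h (isOpen_Ioo.prod isOpen_Ioo) (hf.mono hsub)
    (hg.mono hsub)).of_subset_closure hf hg hsub ?_
  rw [closure_prod_eq, closure_Ioo hab.ne, closure_Ioo hcd.ne]

lemma HasWeakLineDeriv.sub_eq_integral_fst (hab : a < b) (hcd : c < d) (hf : Continuous f)
    (hg : Continuous g) {C C' : ℝ} (hfC : ∀ z, |f z| ≤ C) (hgC : ∀ z, |g z| ≤ C')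
    (h : HasWeakLineDeriv (Ioo a b ×ˢ Ioo c d) (1, 0) f g) {x t : ℝ} (hx : x ∈ Icc a b)
    (ht : t ∈ Icc c d) : f (x, t) - f (a, t) = ∫ s in a..x, g (s, t) := by
  have hint : ∀ {k : ℝ × ℝ → ℝ} {B : ℝ}, Continuous k → (∀ z, |k z| ≤ B) →
      Integrable k ((volIoo a b).prod (volIoo c d)) := fun hk hB =>
    (integrable_const _).mono' hk.aestronglyMeasurable (Eventually.of_forall hB)
  have hae := h.ae_eq_reconstructFst hab (hint hf hfC) (hint hg hgC)
  rw [volIoo_prod_volIoo] at hae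
  have heq := eqOn_Icc_prod_of_ae_eq hab hcd hf.continuousOn (continuous_reconstructFst hab
    (dominatedCaratheodory_of_continuous hf hfC)
    (dominatedCaratheodory_of_continuous hg hgC)).continuousOn hae
  have hslice : ∀ {k : ℝ × ℝ → ℝ}, Continuous k → IntegrableOn (fun s => k (s, t)) (Ioo a b) :=
    fun hk => (by fun_prop : Continuous fun s => _).integrableOn_Icc.mono_set Ioo_subset_Icc_self
  rw [heq ⟨hx, ht⟩, heq ⟨left_mem_Icc.2 hab.le, ht⟩]
  exact reconstruct_sub_left hab (hslice hf) (hslice hg) hx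

lemma HasWeakLineDeriv.sub_eq_integral_snd (hab : a < b) (hcd : c < d) (hf : Continuous f)
    (hg : Continuous g) {C C' : ℝ} (hfC : ∀ z, |f z| ≤ C) (hgC : ∀ z, |g z| ≤ C')
    (h : HasWeakLineDeriv (Ioo a b ×ˢ Ioo c d) (0, 1) f g) {x t : ℝ} (hx : x ∈ Icc a b)
    (ht : t ∈ Icc c d) : f (x, t) - f (x, c) = ∫ r in c..t, g (x, r) := by
  have hswap := h.comp_swap
  rw [preimage_swap_prod] at hswap
  exact hswap.sub_eq_integral_fst hcd hab (hf.comp continuous_swap) (hg.comp continuous_swap)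
    (fun _ => hfC _) (fun _ => hgC _) ht hx

end FundamentalTheorem

section WeakDerivatives

variable {ε b T : ℝ} {φ : ℝ × ℝ → ℝ}

lemma dT_dX_comm (hφ : ContDiff ℝ ∞ φ) : dT (dX φ) = dX (dT φ) := by
  have hφ' : Differentiable ℝ (fderiv ℝ φ) :=
    (hφ.fderiv_right (m := ∞) (by simp)).differentiable (by simp)
  have second_deriv (z v w : ℝ × ℝ) :
      fderiv ℝ (fun y => fderiv ℝ φ y v) z w = fderiv ℝ (fderiv ℝ φ) z w v := by
    rw [fderiv_clm_apply (hφ' z) (differentiableAt_const v)]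
    simp
  ext z
  have hsymm : IsSymmSndFDerivAt ℝ φ z :=
    (contDiff_infty.1 hφ 2).contDiffAt.isSymmSndFDerivAt (by simp)
  unfold dT dX
  rw [second_deriv, second_deriv]
  exact hsymm _ _

lemma iterate_dT_dX (hφ : ContDiff ℝ ∞ φ) (j : ℕ) : dT^[j] (dX φ) = dX (dT^[j] φ) := by
  induction j generalizing φ with
  | zero => rfl
  | succ j ih => rw [Function.iterate_succ_apply, Function.iterate_succ_apply, dT_dX_comm hφ,
      ih (dT_smooth hφ)]

lemma IsTestOn.isTest (hφ : IsTestOn (Om ε b T) φ) : IsTest ε b T φ :=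
  ⟨hφ.contDiff, hφ.hasCompactSupport, hφ.tsupport_subset⟩

lemma H4.isWeakDeriv (u : H4 ε b T) (i j : Fin 5) (h : (i : ℕ) + (j : ℕ) ≤ 4) :
    IsWeakDeriv ε b T i j (u.D 0 0) (u.D i j h) :=
  u.2 ⟨(i, j), h⟩

lemma H4.hasWeakLineDeriv_snd (u : H4 ε b T) {i j j' : Fin 5} (h : (i : ℕ) + (j : ℕ) ≤ 4)
    (h' : (i : ℕ) + (j' : ℕ) ≤ 4) (hj : (j' : ℕ) = j + 1) :
    HasWeakLineDeriv (Om ε b T) (0, 1) (u.D i j h) (u.D i j' h') := by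
  intro φ hφ
  have e := u.isWeakDeriv i j h (dT φ) (hφ.fderiv_apply (0, 1)).isTest
  have e' := u.isWeakDeriv i j' h' φ hφ.isTest
  rw [hj, Function.iterate_succ_apply, e, ← add_assoc, pow_succ, mul_neg_one, neg_mul,
    ← mul_neg] at e'
  exact mul_left_cancel₀ (pow_ne_zero _ (neg_ne_zero.2 one_ne_zero)) e'

lemma H4.hasWeakLineDeriv_fst (u : H4 ε b T) {i i' j : Fin 5} (h : (i : ℕ) + (j : ℕ) ≤ 4)
    (h' : (i' : ℕ) + (j : ℕ) ≤ 4) (hi : (i' : ℕ) = i + 1) :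
    HasWeakLineDeriv (Om ε b T) (1, 0) (u.D i j h) (u.D i' j h') := by
  intro φ hφ
  have e := u.isWeakDeriv i j h (dX φ) (hφ.fderiv_apply (1, 0)).isTest
  have e' := u.isWeakDeriv i' j h' φ hφ.isTest
  rw [iterate_dT_dX hφ.contDiff] at e
  rw [hi, Function.iterate_succ_apply, e, add_right_comm, pow_succ, mul_neg_one, neg_mul,
    ← mul_neg] at e'
  exact mul_left_cancel₀ (pow_ne_zero _ (neg_ne_zero.2 one_ne_zero)) e'

lemma H4.norm_D_le (u : H4 ε b T) (i j : Fin 5) (h : (i : ℕ) + (j : ℕ) ≤ 4) :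
    ‖u.D i j h‖ ≤ ‖u‖ :=
  PiLp.norm_apply_le (p := 2) (β := fun _ : Idx => L2 ε b T) u.1 ⟨(i, j), h⟩

end WeakDerivatives

section SquareIntegrable

variable {α : Type*} {mα : MeasurableSpace α} {μ : Measure α}

lemma norm_sq_eq_integral (g : Lp ℝ 2 μ) : ‖g‖ ^ 2 = ∫ z, g z ^ 2 ∂μ := by
  rw [← real_inner_self_eq_norm_sq, L2.inner_def]
  exact integral_congr_ae (Eventually.of_forall fun z => by simp [sq])

lemma integral_abs_le_norm [IsFiniteMeasure μ] (g : Lp ℝ 2 μ) :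
    ∫ z, |g z| ∂μ ≤ ‖Lp.const 2 μ (1 : ℝ)‖ * ‖g‖ :=
  calc ∫ z, |g z| ∂μ = inner ℝ (Lp.const 2 μ (1 : ℝ)) |g| := by
        rw [L2.inner_def]
        refine integral_congr_ae ?_
        filter_upwards [Lp.coeFn_abs g, Lp.coeFn_const 2 μ (1 : ℝ)] with z h_abs h_const
        simp only [RCLike.inner_apply, conj_trivial, h_abs, h_const, Function.const_apply, mul_one]
    _ ≤ ‖Lp.const 2 μ (1 : ℝ)‖ * ‖|g|‖ := real_inner_le_norm _ _
    _ = ‖Lp.const 2 μ (1 : ℝ)‖ * ‖g‖ := by rw [norm_abs_eq_norm]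

lemma continuous_integral_mul {ψ : α → ℝ} (hψ : MemLp ψ 2 μ) :
    Continuous fun g : Lp ℝ 2 μ => ∫ z, g z * ψ z ∂μ := by
  have e : (fun g : Lp ℝ 2 μ => ∫ z, g z * ψ z ∂μ) = fun g => inner ℝ (hψ.toLp ψ) g := by
    ext g
    rw [L2.inner_def]
    refine integral_congr_ae ?_
    filter_upwards [hψ.coeFn_toLp] with z hz
    simp [hz]
  rw [e]
  fun_prop

end SquareIntegrable

section Completeness

variable {ε b T : ℝ}

lemma isClosed_setOf_isWeakDeriv (k : Idx) :
    IsClosed {U : PiLp 2 fun _ : Idx => L2 ε b T |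
      IsWeakDeriv ε b T (k.1.1 : ℕ) (k.1.2 : ℕ) (U idx0) (U k)} := by
  have : IsFiniteMeasureOnCompacts (muOm ε b T) := by unfold muOm; infer_instance
  simp only [IsWeakDeriv, ofPred_forall]
  refine isClosed_iInter fun φ => isClosed_iInter fun hφ => isClosed_eq ?_ ?_
  · obtain ⟨hψ, hψc⟩ := iter_good hφ.1 hφ.2.1 (k.1.1 : ℕ) (k.1.2 : ℕ)
    exact (continuous_integral_mul (hψ.continuous.memLp_of_hasCompactSupport hψc)).comp
      (PiLp.continuous_apply 2 _ idx0)
  · exact continuous_const.mul ((continuous_integral_mul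
      (hφ.1.continuous.memLp_of_hasCompactSupport hφ.2.1)).comp (PiLp.continuous_apply 2 _ k))

instance : CompleteSpace (H4 ε b T) := by
  have : IsClosed (H4Sub ε b T : Set (PiLp 2 fun _ : Idx => L2 ε b T)) := by
    have e : (H4Sub ε b T : Set (PiLp 2 fun _ : Idx => L2 ε b T)) =
        ⋂ k : Idx, {U | IsWeakDeriv ε b T (k.1.1 : ℕ) (k.1.2 : ℕ) (U idx0) (U k)} :=
      ofPred_forall _
    rw [e]
    exact isClosed_iInter isClosed_setOf_isWeakDeriv
  exact this.completeSpace_coe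

end Completeness

section ContinuousRepresentative

variable {ε b T : ℝ}

lemma muOm_eq_prod (ε b T : ℝ) : muOm ε b T = (volIoo ε b).prod (volIoo 0 T) :=
  (volIoo_prod_volIoo ε b 0 T).symm

instance : IsFiniteMeasure (muOm ε b T) := by
  rw [muOm_eq_prod]
  infer_instance

lemma L2.integrable (g : L2 ε b T) : Integrable g (muOm ε b T) :=
  (Lp.memLp g).integrable one_le_two

/-- The representative of `∂ₓⁱ ∂ₜʲ u`, for `i + j ≤ 2`, that is continuous on the whole plane and
is obtained from the derivatives of `u` of orders `i + j`, `i + j + 1` and `i + j + 2`. -/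
def H4.rep (u : H4 ε b T) (i j : Fin 5) (h : (i : ℕ) + (j : ℕ) ≤ 2 := by decide) : ℝ × ℝ → ℝ :=
  reconstructRect ε b 0 T (u.D i j (by omega)) (u.D ⟨i + 1, by omega⟩ j (by dsimp; omega))
    (u.D i ⟨j + 1, by omega⟩ (by dsimp; omega))
    (u.D ⟨i + 1, by omega⟩ ⟨j + 1, by omega⟩ (by dsimp; omega))

/-- The constant of the embedding of `H⁴(Ω)` into `C²` of the closed rectangle. -/
def embeddingBound (ε b T : ℝ) : ℝ :=
  stepBound ε b * stepBound 0 T * (4 * ‖Lp.const 2 (muOm ε b T) (1 : ℝ)‖)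

lemma embeddingBound_nonneg (ε b T : ℝ) : 0 ≤ embeddingBound ε b T := by
  have := (stepBound_pos ε b).le
  have := (stepBound_pos 0 T).le
  unfold embeddingBound
  positivity

lemma H4.continuous_rep (hεb : ε < b) (hT : 0 < T) (u : H4 ε b T) (i j : Fin 5)
    (h : (i : ℕ) + (j : ℕ) ≤ 2) : Continuous (u.rep i j h) := by
  apply continuous_reconstructRect hεb hT <;> exact muOm_eq_prod ε b T ▸ L2.integrable _

lemma H4.ae_eq_rep (hεb : ε < b) (hT : 0 < T) (u : H4 ε b T) (i j : Fin 5)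
    (h : (i : ℕ) + (j : ℕ) ≤ 2) : u.D i j (by omega) =ᵐ[muOm ε b T] u.rep i j h := by
  rw [congrArg ae (muOm_eq_prod ε b T)]
  apply ae_eq_reconstructRect hεb hT
  iterate 4 exact muOm_eq_prod ε b T ▸ L2.integrable _
  exacts [u.hasWeakLineDeriv_fst _ _ rfl, u.hasWeakLineDeriv_snd _ _ rfl,
    u.hasWeakLineDeriv_snd _ _ rfl]

lemma H4.abs_rep_le (hεb : ε < b) (hT : 0 < T) (u : H4 ε b T) (i j : Fin 5)
    (h : (i : ℕ) + (j : ℕ) ≤ 2) (z : ℝ × ℝ) : |u.rep i j h z| ≤ embeddingBound ε b T * ‖u‖ := by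
  have integral_abs_D_le (i j : Fin 5) (h : (i : ℕ) + (j : ℕ) ≤ 4) :
      ∫ z, |u.D i j h z| ∂(muOm ε b T) ≤ ‖Lp.const 2 (muOm ε b T) (1 : ℝ)‖ * ‖u‖ :=
    (integral_abs_le_norm _).trans
      (mul_le_mul_of_nonneg_left (u.norm_D_le i j h) (norm_nonneg _))
  have integrable_abs_D (i j : Fin 5) (h : (i : ℕ) + (j : ℕ) ≤ 4) :
      Integrable (fun z => |u.D i j h z|) (muOm ε b T) := (L2.integrable _).abs
  refine (abs_reconstructRect_le hεb hT ?_ ?_ ?_ ?_ z).trans ?_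
  iterate 4 exact muOm_eq_prod ε b T ▸ L2.integrable _
  have := (stepBound_pos ε b).le
  have := (stepBound_pos 0 T).le
  rw [embeddingBound, mul_assoc (stepBound ε b * stepBound 0 T), ← muOm_eq_prod,
    integral_add ((integrable_abs_D _ _ _).fun_add (integrable_abs_D _ _ _))
      ((integrable_abs_D _ _ _).fun_add (integrable_abs_D _ _ _)),
    integral_add (integrable_abs_D _ _ _) (integrable_abs_D _ _ _),
    integral_add (integrable_abs_D _ _ _) (integrable_abs_D _ _ _)]
  gcongr
  linarith [integral_abs_D_le i j (by omega),
    integral_abs_D_le ⟨i + 1, by omega⟩ j (by dsimp; omega),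
    integral_abs_D_le i ⟨j + 1, by omega⟩ (by dsimp; omega),
    integral_abs_D_le ⟨i + 1, by omega⟩ ⟨j + 1, by omega⟩ (by dsimp; omega)]

lemma H4.rep_sub_eq_integral_fst (hεb : ε < b) (hT : 0 < T) (u : H4 ε b T) {i i' j : Fin 5}
    (h : (i : ℕ) + (j : ℕ) ≤ 2) (h' : (i' : ℕ) + (j : ℕ) ≤ 2) (hi : (i' : ℕ) = i + 1) {x t : ℝ}
    (hx : x ∈ Icc ε b) (ht : t ∈ Icc 0 T) :
    u.rep i j h (x, t) - u.rep i j h (ε, t) = ∫ s in ε..x, u.rep i' j h' (s, t) :=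
  ((u.hasWeakLineDeriv_fst (by omega) (by omega) hi).congr_ae (u.ae_eq_rep hεb hT i j h)
    (u.ae_eq_rep hεb hT i' j h')).sub_eq_integral_fst hεb hT (u.continuous_rep hεb hT i j h)
    (u.continuous_rep hεb hT i' j h') (u.abs_rep_le hεb hT i j h) (u.abs_rep_le hεb hT i' j h')
    hx ht

lemma H4.rep_sub_eq_integral_snd (hεb : ε < b) (hT : 0 < T) (u : H4 ε b T) {i j j' : Fin 5}
    (h : (i : ℕ) + (j : ℕ) ≤ 2) (h' : (i : ℕ) + (j' : ℕ) ≤ 2) (hj : (j' : ℕ) = j + 1) {x t : ℝ}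
    (hx : x ∈ Icc ε b) (ht : t ∈ Icc 0 T) :
    u.rep i j h (x, t) - u.rep i j h (x, 0) = ∫ r in 0..t, u.rep i j' h' (x, r) :=
  ((u.hasWeakLineDeriv_snd (by omega) (by omega) hj).congr_ae (u.ae_eq_rep hεb hT i j h)
    (u.ae_eq_rep hεb hT i j' h')).sub_eq_integral_snd hεb hT (u.continuous_rep hεb hT i j h)
    (u.continuous_rep hεb hT i j' h') (u.abs_rep_le hεb hT i j h) (u.abs_rep_le hεb hT i j' h')
    hx ht

lemma IsContRep.eqOn (hεb : ε < b) (hT : 0 < T) {u : L2 ε b T} {f g : ℝ × ℝ → ℝ}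
    (hf : IsContRep ε b T u f) (hg : IsContRep ε b T u g) : EqOn f g (OmBar ε b T) :=
  eqOn_Icc_prod_of_ae_eq hεb hT hf.1 hg.1 (hf.2.symm.trans hg.2)

lemma H4.isContRep_rep (hεb : ε < b) (hT : 0 < T) (u : H4 ε b T) (i j : Fin 5)
    (h : (i : ℕ) + (j : ℕ) ≤ 2) : IsContRep ε b T (u.D i j (by omega)) (u.rep i j h) :=
  ⟨(u.continuous_rep hεb hT i j h).continuousOn, u.ae_eq_rep hεb hT i j h⟩

lemma H4.contRep_eqOn_rep (hεb : ε < b) (hT : 0 < T) (u : H4 ε b T) (i j : Fin 5)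
    (h : (i : ℕ) + (j : ℕ) ≤ 2) :
    EqOn (contRep (u.D i j (by omega))) (u.rep i j h) (OmBar ε b T) := by
  have hu := u.isContRep_rep hεb hT i j h
  have hex : ∃ f, IsContRep ε b T (u.D i j (by omega)) f := ⟨_, hu⟩
  rw [contRep, dif_pos hex]
  exact hex.choose_spec.eqOn hεb hT hu

lemma H4.rep_sub_eqOn (hεb : ε < b) (hT : 0 < T) (u v : H4 ε b T) (i j : Fin 5)
    (h : (i : ℕ) + (j : ℕ) ≤ 2) :
    EqOn ((u - v).rep i j h) (u.rep i j h - v.rep i j h) (OmBar ε b T) := by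
  have hu := u.isContRep_rep hεb hT i j h
  have hv := v.isContRep_rep hεb hT i j h
  exact ((u - v).isContRep_rep hεb hT i j h).eqOn hεb hT
    ⟨hu.1.sub hv.1, (Lp.coeFn_sub _ _).trans (hu.2.sub hv.2)⟩

lemma H4.continuous_rep_apply (hεb : ε < b) (hT : 0 < T) (i j : Fin 5)
    (h : (i : ℕ) + (j : ℕ) ≤ 2) {z : ℝ × ℝ} (hz : z ∈ OmBar ε b T) :
    Continuous fun u : H4 ε b T => u.rep i j h z := by
  refine LipschitzWith.continuous (K := (embeddingBound ε b T).toNNReal)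
    (.of_dist_le_mul fun u v => ?_)
  rw [Real.coe_toNNReal _ (embeddingBound_nonneg ε b T), dist_eq_norm, dist_eq_norm,
    Real.norm_eq_abs, ← Pi.sub_apply, ← H4.rep_sub_eqOn hεb hT u v i j h hz]
  exact (u - v).abs_rep_le hεb hT i j h z

end ContinuousRepresentative

section LateralConditions

variable {ε b T : ℝ} {p r : ℝ → ℝ}

lemma left_mem_OmBar (hεb : ε < b) {t : ℝ} (ht : t ∈ Ioo 0 T) : (ε, t) ∈ OmBar ε b T :=
  ⟨left_mem_Icc.2 hεb.le, Ioo_subset_Icc_self ht⟩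

lemma right_mem_OmBar (hεb : ε < b) {t : ℝ} (ht : t ∈ Ioo 0 T) : (b, t) ∈ OmBar ε b T :=
  ⟨right_mem_Icc.2 hεb.le, Ioo_subset_Icc_self ht⟩

lemma bottom_mem_OmBar (hT : 0 < T) {x : ℝ} (hx : x ∈ Icc ε b) : (x, 0) ∈ OmBar ε b T :=
  ⟨hx, left_mem_Icc.2 hT.le⟩

/-- The functions in `H⁴(Ω)` with the lateral Cauchy data `u = p`, `uₓ = r` on `x = ε` and `uₓ = 0`
on `x = b`. -/
def lateralSet (ε b T : ℝ) (p r : ℝ → ℝ) : Set (H4 ε b T) :=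
  {u | ∀ t ∈ Ioo 0 T, (u.rep 0 0) (ε, t) = p t ∧ (u.rep 1 0) (ε, t) = r t ∧ (u.rep 1 0) (b, t) = 0}

lemma mem_lateralSet_iff (hεb : ε < b) (hT : 0 < T) {u : H4 ε b T} {f fx : ℝ × ℝ → ℝ}
    (hf : IsContRep ε b T (u.D 0 0) f) (hfx : IsContRep ε b T (u.D 1 0) fx) :
    u ∈ lateralSet ε b T p r ↔
      ∀ t ∈ Ioo 0 T, f (ε, t) = p t ∧ fx (ε, t) = r t ∧ fx (b, t) = 0 := by
  have e := (u.isContRep_rep hεb hT 0 0 (by decide)).eqOn hεb hT hf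
  have ex := (u.isContRep_rep hεb hT 1 0 (by decide)).eqOn hεb hT hfx
  refine forall₂_congr fun t ht => ?_
  rw [e (left_mem_OmBar hεb ht), ex (left_mem_OmBar hεb ht), ex (right_mem_OmBar hεb ht)]

lemma isClosed_lateralSet (hεb : ε < b) (hT : 0 < T) (p r : ℝ → ℝ) :
    IsClosed (lateralSet ε b T p r) := by
  simp only [lateralSet, ofPred_forall, ofPred_and]
  refine isClosed_iInter fun t => isClosed_iInter fun ht => IsClosed.inter ?_ (IsClosed.inter ?_ ?_)
  · exact isClosed_eq (H4.continuous_rep_apply hεb hT 0 0 _ (left_mem_OmBar hεb ht))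
      continuous_const
  · exact isClosed_eq (H4.continuous_rep_apply hεb hT 1 0 _ (left_mem_OmBar hεb ht))
      continuous_const
  · exact isClosed_eq (H4.continuous_rep_apply hεb hT 1 0 _ (right_mem_OmBar hεb ht))
      continuous_const

lemma coe_H40_eq_lateralSet (hεb : ε < b) (hT : 0 < T) :
    (H40 ε b T : Set (H4 ε b T)) = lateralSet ε b T 0 0 :=
  Subset.antisymm (fun _ ⟨_, _, hf, hfx, h⟩ => (mem_lateralSet_iff hεb hT hf hfx).2 h)
    fun u hu => ⟨_, _, u.isContRep_rep hεb hT 0 0 _, u.isContRep_rep hεb hT 1 0 _, hu⟩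

lemma completeSpace_H40 (hεb : ε < b) (hT : 0 < T) : CompleteSpace (H40 ε b T) := by
  have : IsClosed (H40 ε b T : Set (H4 ε b T)) := by
    rw [coe_H40_eq_lateralSet hεb hT]
    exact isClosed_lateralSet hεb hT 0 0
  exact this.completeSpace_coe

lemma sub_mem_H40_of_mem_lateralSet (hεb : ε < b) (hT : 0 < T) {u v : H4 ε b T}
    (hu : u ∈ lateralSet ε b T p r) (hv : v ∈ lateralSet ε b T p r) : u - v ∈ H40 ε b T := by
  rw [← SetLike.mem_coe, coe_H40_eq_lateralSet hεb hT]
  intro t ht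
  obtain ⟨hu₁, hu₂, hu₃⟩ := hu t ht
  obtain ⟨hv₁, hv₂, hv₃⟩ := hv t ht
  simp [H4.rep_sub_eqOn hεb hT u v _ _ _ (left_mem_OmBar hεb ht),
    H4.rep_sub_eqOn hεb hT u v _ _ _ (right_mem_OmBar hεb ht), hu₁, hu₂, hu₃, hv₁, hv₂, hv₃]

variable {R : ℝ} {g₀ : ℝ → ℝ}

lemma sub_mem_H40_of_mem_closure_admB (hεb : ε < b) (hT : 0 < T) {u v : H4 ε b T}
    (hu : u ∈ closure (admB ε b T R g₀)) (hv : v ∈ closure (admB ε b T R g₀)) :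
    u - v ∈ H40 ε b T := by
  have h : closure (admB ε b T R g₀) ⊆
      lateralSet ε b T (fun t => g₀ (t + ε)) fun t => 2 * deriv g₀ (t + ε) :=
    closure_minimal (fun _ ⟨_, _, _, hf, hfx, h, _⟩ => (mem_lateralSet_iff hεb hT hf hfx).2 h)
      (isClosed_lateralSet hεb hT _ _)
  exact sub_mem_H40_of_mem_lateralSet hεb hT (h hu) (h hv)

lemma norm_le_of_mem_closure_admB {q : H4 ε b T} (hq : q ∈ closure (admB ε b T R g₀)) :
    ‖q‖ ≤ R :=
  closure_minimal (fun _ hq => hq.1.le) (isClosed_le continuous_norm continuous_const) hq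

lemma convex_admB : Convex ℝ (admB ε b T R g₀) := by
  rintro p ⟨hp, f, fx, hf, hfx, hf_lat, hf_bot⟩ q ⟨hq, g, gx, hg, hgx, hg_lat, hg_bot⟩ s r hs hr hsr
  refine ⟨?_, s • f + r • g, s • fx + r • gx, contRep_add (contRep_smul s hf) (contRep_smul r hg),
    contRep_add (contRep_smul s hfx) (contRep_smul r hgx), fun t ht => ?_, fun x hx => ?_⟩
  · simpa using convex_ball (0 : H4 ε b T) R (by simpa using hp) (by simpa using hq) hs hr hsr
  · obtain ⟨hf₁, hf₂, hf₃⟩ := hf_lat t ht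
    obtain ⟨hg₁, hg₂, hg₃⟩ := hg_lat t ht
    simp [hf₁, hf₂, hf₃, hg₁, hg₂, hg₃, ← add_mul, hsr]
  · exact convex_Icc (qLow b) (1 / 2) (hf_bot x hx) (hg_bot x hx) hs hr hsr

end LateralConditions

section Tikhonov

variable {E F : Type*} [NormedAddCommGroup E] [InnerProductSpace ℝ E]
  [NormedAddCommGroup F] [InnerProductSpace ℝ F]

/-- The Tikhonov functional with operator `A`, data `-B` and regularization parameter `β`. -/
def tikhonov (A : E →L[ℝ] F) (B : F) (β : ℝ) (q : E) : ℝ := ‖A q + B‖ ^ 2 + β * ‖q‖ ^ 2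

/-- The derivative of the Tikhonov functional. -/
def tikhonovDeriv (A : E →L[ℝ] F) (B : F) (β : ℝ) (q : E) : E →L[ℝ] ℝ :=
  (2 : ℝ) • (innerSL ℝ (A q + B)).comp A + (2 * β) • innerSL ℝ q

variable (A : E →L[ℝ] F) (B : F) (β : ℝ)

lemma tikhonovDeriv_apply (q h : E) :
    tikhonovDeriv A B β q h = 2 * inner ℝ (A q + B) (A h) + 2 * β * inner ℝ q h :=
  rfl

lemma tikhonov_add (q h : E) : tikhonov A B β (q + h) =
    tikhonov A B β q + tikhonovDeriv A B β q h + (‖A h‖ ^ 2 + β * ‖h‖ ^ 2) := by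
  rw [tikhonov, tikhonov, tikhonovDeriv_apply, map_add, add_right_comm, norm_add_sq_real,
    norm_add_sq_real q]
  ring

lemma hasFDerivAt_tikhonov (q : E) :
    HasFDerivAt (tikhonov A B β) (tikhonovDeriv A B β q) q := by
  refine ((A.hasFDerivAt.add_const B).norm_sq.add
    ((hasFDerivAt_id q).norm_sq.const_mul β)).congr_fderiv ?_
  ext h
  simp [tikhonovDeriv_apply, inner_add_left]
  ring

lemma hasFDerivAt_tikhonov_add_coe (S : Submodule ℝ E) (q : E) :
    HasFDerivAt (fun h : S => tikhonov A B β (q + h)) ((tikhonovDeriv A B β q).comp S.subtypeL)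
      0 := by
  have h : HasFDerivAt (tikhonov A B β) (tikhonovDeriv A B β q) (q + S.subtypeL 0) := by
    simpa using hasFDerivAt_tikhonov A B β q
  exact h.comp 0 (S.subtypeL.hasFDerivAt.const_add q)

variable {A B β}

lemma innerSL_eq_of_hasFDerivAt {S : Submodule ℝ E} {q : E} {g : S}
    (hg : HasFDerivAt (fun h : S => tikhonov A B β (q + h)) (innerSL ℝ g) 0) :
    innerSL ℝ g = (tikhonovDeriv A B β q).comp S.subtypeL :=
  hg.unique (hasFDerivAt_tikhonov_add_coe A B β S q)

lemma exists_gradient_tikhonov (S : Submodule ℝ E) [CompleteSpace S] (q : E) : ∃ g : S,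
    HasFDerivAt (fun h : S => tikhonov A B β (q + h)) (innerSL ℝ g) 0 := by
  refine ⟨(InnerProductSpace.toDual ℝ S).symm ((tikhonovDeriv A B β q).comp S.subtypeL), ?_⟩
  refine (hasFDerivAt_tikhonov_add_coe A B β S q).congr_fderiv ?_
  exact ((InnerProductSpace.toDual ℝ S).apply_symm_apply _).symm

lemma norm_tikhonovDeriv_sub_le (q₁ q₂ : E) :
    ‖tikhonovDeriv A B β q₂ - tikhonovDeriv A B β q₁‖ ≤
      (2 * ‖A‖ ^ 2 + 2 * |β|) * ‖q₂ - q₁‖ := by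
  have e : tikhonovDeriv A B β q₂ - tikhonovDeriv A B β q₁ =
      (2 : ℝ) • (innerSL ℝ (A (q₂ - q₁))).comp A + (2 * β) • innerSL ℝ (q₂ - q₁) := by
    ext h
    simp only [sub_apply, add_apply, smul_apply, ContinuousLinearMap.comp_apply,
      innerSL_apply_apply, tikhonovDeriv_apply, smul_eq_mul, map_sub, inner_add_left]
    ring
  calc ‖tikhonovDeriv A B β q₂ - tikhonovDeriv A B β q₁‖
      ≤ 2 * (‖A (q₂ - q₁)‖ * ‖A‖) + 2 * |β| * ‖q₂ - q₁‖ := by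
        rw [e]
        refine (norm_add_le _ _).trans (add_le_add ?_ ?_)
        · rw [norm_smul, Real.norm_ofNat, ← innerSL_apply_norm ℝ (A (q₂ - q₁))]
          gcongr
          exact ContinuousLinearMap.opNorm_comp_le _ _
        · rw [norm_smul, innerSL_apply_norm, norm_mul, Real.norm_ofNat, Real.norm_eq_abs]
    _ ≤ 2 * (‖A‖ * ‖q₂ - q₁‖ * ‖A‖) + 2 * |β| * ‖q₂ - q₁‖ := by
        gcongr
        exact A.le_opNorm _
    _ = (2 * ‖A‖ ^ 2 + 2 * |β|) * ‖q₂ - q₁‖ := by ring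

lemma norm_gradient_tikhonov_sub_le {S : Submodule ℝ E} {q₁ q₂ : E} {g₁ g₂ : S}
    (hg₁ : HasFDerivAt (fun h : S => tikhonov A B β (q₁ + h)) (innerSL ℝ g₁) 0)
    (hg₂ : HasFDerivAt (fun h : S => tikhonov A B β (q₂ + h)) (innerSL ℝ g₂) 0) :
    ‖g₂ - g₁‖ ≤ (2 * ‖A‖ ^ 2 + 2 * |β|) * ‖q₂ - q₁‖ :=
  calc ‖g₂ - g₁‖ = ‖(tikhonovDeriv A B β q₂ - tikhonovDeriv A B β q₁).comp S.subtypeL‖ := by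
        rw [ContinuousLinearMap.sub_comp, ← innerSL_eq_of_hasFDerivAt hg₁,
          ← innerSL_eq_of_hasFDerivAt hg₂, ← map_sub, innerSL_apply_norm]
    _ ≤ ‖tikhonovDeriv A B β q₂ - tikhonovDeriv A B β q₁‖ * ‖S.subtypeL‖ :=
        ContinuousLinearMap.opNorm_comp_le _ _
    _ ≤ ‖tikhonovDeriv A B β q₂ - tikhonovDeriv A B β q₁‖ :=
        mul_le_of_le_one_right (norm_nonneg _) S.norm_subtypeL_le
    _ ≤ (2 * ‖A‖ ^ 2 + 2 * |β|) * ‖q₂ - q₁‖ := norm_tikhonovDeriv_sub_le q₁ q₂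

variable {K : Set E}

lemma strictConvexOn_tikhonov (hK : Convex ℝ K) (hβ : 0 < β) :
    StrictConvexOn ℝ K (tikhonov A B β) := by
  refine StrongConvexOn.strictConvexOn (m := 2 * β) (strongConvexOn_iff_convex.2 ?_)
    (by positivity)
  have convexOn_residual : ConvexOn ℝ K fun q => ‖A q + B‖ :=
    ((convexOn_univ_norm.translate_left B).comp_linearMap A.toLinearMap).subset (subset_univ _) hK
  refine (convexOn_residual.pow (fun _ _ => norm_nonneg _) 2).congr fun q _ => ?_
  simp [tikhonov]

/-- The operator `q ↦ (A q, √β q)`, for which `tikhonov A B β q` is the squared distance from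
`(-B, 0)` to the image of `q`. -/
def augmented (A : E →L[ℝ] F) (β : ℝ) : E →L[ℝ] WithLp 2 (F × E) :=
  (WithLp.prodContinuousLinearEquiv 2 ℝ F E).symm.toContinuousLinearMap.comp
    (A.prod (√β • ContinuousLinearMap.id ℝ E))

lemma norm_sub_augmented_sq (hβ : 0 ≤ β) (q : E) :
    ‖WithLp.toLp 2 (-B, (0 : E)) - augmented A β q‖ ^ 2 = tikhonov A B β q := by
  have h_fst : (WithLp.toLp 2 (-B, (0 : E)) - augmented A β q).fst = -(A q + B) :=
    (neg_add' B (A q)).symm.trans (congrArg _ (add_comm _ _))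
  have h_snd : (WithLp.toLp 2 (-B, (0 : E)) - augmented A β q).snd = -(√β • q) :=
    zero_sub _
  rw [WithLp.prod_norm_sq_eq_of_L2, h_fst, h_snd, norm_neg, norm_neg, norm_smul, mul_pow,
    Real.norm_eq_abs, sq_abs, Real.sq_sqrt hβ, tikhonov]

lemma antilipschitzWith_augmented (hβ : 0 < β) :
    AntilipschitzWith (√β).toNNReal⁻¹ (augmented A β) := by
  refine ContinuousLinearMap.antilipschitz_of_bound _ fun q => ?_
  have h_snd : √β * ‖q‖ = ‖(augmented A β q).snd‖ := by
    rw [show (augmented A β q).snd = √β • q from rfl, norm_smul, Real.norm_eq_abs,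
      abs_of_nonneg (Real.sqrt_nonneg β)]
  rw [NNReal.coe_inv, Real.coe_toNNReal _ (Real.sqrt_nonneg β),
    le_inv_mul_iff₀ (Real.sqrt_pos.2 hβ), h_snd]
  exact WithLp.norm_snd_le F (augmented A β q)

lemma exists_forall_tikhonov_le [CompleteSpace E] (hK : Convex ℝ K) (hK_closed : IsClosed K)
    (hK_ne : K.Nonempty) (hβ : 0 < β) :
    ∃ p ∈ K, ∀ q ∈ K, tikhonov A B β p ≤ tikhonov A B β q := by
  have complete_image : IsComplete (augmented A β '' K) :=
    (isComplete_image_iff ((antilipschitzWith_augmented hβ).isUniformInducing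
      (augmented A β).uniformContinuous)).2 hK_closed.isComplete
  obtain ⟨_, ⟨p, hp, rfl⟩, hp_dist⟩ := exists_norm_eq_iInf_of_complete_convex
    (hK_ne.image (augmented A β)) complete_image (hK.linear_image (augmented A β).toLinearMap)
    (WithLp.toLp 2 (-B, 0))
  refine ⟨p, hp, fun q hq => ?_⟩
  rw [← norm_sub_augmented_sq hβ.le, ← norm_sub_augmented_sq hβ.le, hp_dist]
  refine pow_le_pow_left₀ (Real.iInf_nonneg fun _ => norm_nonneg _) ?_ 2
  exact ciInf_le ⟨0, by rintro _ ⟨w, rfl⟩; exact norm_nonneg _⟩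
    (⟨augmented A β q, mem_image_of_mem _ hq⟩ : ↥(augmented A β '' K))

end Tikhonov

section Hardy

open scoped NNReal

/-- The function `g` on `[a, b]` has the continuous derivative `g'`. Both functions are taken
continuous on `ℝ`, and the derivative is recorded through the fundamental theorem of calculus, which
includes the end points. -/
structure IsPrimitiveOn (g g' : ℝ → ℝ) (a b : ℝ) : Prop where
  continuous : Continuous g
  continuous_deriv : Continuous g'
  sub_eq_integral : ∀ x ∈ Icc a b, g x - g a = ∫ s in a..x, g' s

variable {a b : ℝ} {g g' : ℝ → ℝ}

namespace IsPrimitiveOn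

lemma hasDerivAt (h : IsPrimitiveOn g g' a b) {x : ℝ} (hx : x ∈ Ioo a b) :
    HasDerivAt g (g' x) x := by
  have deriv_integral : HasDerivAt (fun x => ∫ s in a..x, g' s) (g' x) x :=
    intervalIntegral.integral_hasDerivAt_right (h.continuous_deriv.intervalIntegrable _ _)
      (h.continuous_deriv.stronglyMeasurableAtFilter _ _) h.continuous_deriv.continuousAt
  refine (deriv_integral.add_const (g a)).congr_of_eventuallyEq ?_
  filter_upwards [Icc_mem_nhds hx.1 hx.2] with y hy
  exact sub_eq_iff_eq_add.1 (h.sub_eq_integral y hy)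

lemma lipschitzOnWith (h : IsPrimitiveOn g g' a b) {K : ℝ} (hK₀ : 0 ≤ K)
    (hK : ∀ x ∈ Icc a b, |g' x| ≤ K) : LipschitzOnWith K.toNNReal g (Icc a b) := by
  refine LipschitzOnWith.of_dist_le_mul fun x hx y hy => ?_
  rw [Real.coe_toNNReal _ hK₀, Real.dist_eq, Real.dist_eq, ← sub_sub_sub_cancel_right _ _ (g a),
    h.sub_eq_integral x hx, h.sub_eq_integral y hy, intervalIntegral.integral_interval_sub_left
      (h.continuous_deriv.intervalIntegrable _ _) (h.continuous_deriv.intervalIntegrable _ _)]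
  exact intervalIntegral.norm_integral_le_of_norm_le_const (C := K) (f := g') fun s hs =>
    hK s (uIcc_subset_Icc hy hx (uIoc_subset_uIcc hs))

lemma absolutelyContinuousOnInterval (h : IsPrimitiveOn g g' a b) (hab : a ≤ b) :
    AbsolutelyContinuousOnInterval g a b := by
  obtain ⟨K, hK⟩ := (isCompact_Icc (a := a) (b := b)).exists_bound_of_continuousOn
    h.continuous_deriv.continuousOn
  have K_nonneg : 0 ≤ K := (norm_nonneg _).trans (hK a (left_mem_Icc.2 hab))
  have lipschitz := h.lipschitzOnWith K_nonneg hK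
  rw [← uIcc_of_le hab] at lipschitz
  exact lipschitz.absolutelyContinuousOnInterval

end IsPrimitiveOn

/-- The exponential weight `e^{-2κx + μ}`, the restriction of the Carleman weight to a line parallel
to one of the axes. -/
def expWeight (κ μ x : ℝ) : ℝ := Real.exp (-2 * κ * x + μ)

lemma expWeight_pos (κ μ x : ℝ) : 0 < expWeight κ μ x := Real.exp_pos _

lemma contDiff_expWeight (κ μ : ℝ) : ContDiff ℝ 1 (expWeight κ μ) := by
  unfold expWeight
  fun_prop

@[fun_prop]
lemma continuous_expWeight (κ μ : ℝ) : Continuous (expWeight κ μ) :=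
  (contDiff_expWeight κ μ).continuous

lemma hasDerivAt_sq_mul_expWeight {y : ℝ → ℝ} {p x : ℝ} (hy : HasDerivAt y p x) (κ μ : ℝ) :
    HasDerivAt (fun x => y x ^ 2 * expWeight κ μ x)
      (2 * (y x * p * expWeight κ μ x) - 2 * κ * (y x ^ 2 * expWeight κ μ x)) x := by
  have weight_deriv : HasDerivAt (expWeight κ μ) (expWeight κ μ x * (-2 * κ)) x := by
    have := (((hasDerivAt_id x).const_mul (-2 * κ)).add_const μ).exp
    rwa [mul_one] at this
  refine ((hy.fun_pow 2).fun_mul weight_deriv).congr_deriv ?_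
  push_cast
  ring

lemma IsPrimitiveOn.integral_mul_deriv_mul_expWeight (h : IsPrimitiveOn g g' a b) (hab : a ≤ b)
    (κ μ : ℝ) : ∫ x in a..b, g x * g' x * expWeight κ μ x =
      (g b ^ 2 * expWeight κ μ b - g a ^ 2 * expWeight κ μ a) / 2 +
        κ * ∫ x in a..b, g x ^ 2 * expWeight κ μ x := by
  have continuous_g := h.continuous
  have continuous_g' := h.continuous_deriv
  have ftc := intervalIntegral.integral_eq_sub_of_hasDerivAt_of_le hab
    (Continuous.continuousOn (by fun_prop))
    (fun x hx => hasDerivAt_sq_mul_expWeight (h.hasDerivAt hx) κ μ)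
    (Continuous.intervalIntegrable (by fun_prop) _ _)
  rw [intervalIntegral.integral_sub (Continuous.intervalIntegrable (by fun_prop) _ _)
    (Continuous.intervalIntegrable (by fun_prop) _ _), intervalIntegral.integral_const_mul,
    intervalIntegral.integral_const_mul] at ftc
  linarith

section AbsolutelyContinuous

variable {y W : ℝ → ℝ} {κ : ℝ}

lemma deriv_sq_mul_expWeight_le {x : ℝ} (hy : DifferentiableAt ℝ y x) (hκ : 0 < κ)
    (hW : deriv y x ^ 2 ≤ W x) (μ : ℝ) :
    deriv (fun x => y x ^ 2 * expWeight κ μ x) x ≤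
      κ⁻¹ * (W x * expWeight κ μ x) - κ * (y x ^ 2 * expWeight κ μ x) := by
  rw [(hasDerivAt_sq_mul_expWeight hy.hasDerivAt κ μ).deriv]
  have young : 2 * (y x * deriv y x) ≤ κ * y x ^ 2 + κ⁻¹ * W x := by
    have square : κ⁻¹ * (κ * y x - deriv y x) ^ 2 =
        κ * y x ^ 2 - 2 * (y x * deriv y x) + κ⁻¹ * deriv y x ^ 2 := by
      field_simp
      ring
    have square_nonneg : 0 ≤ κ⁻¹ * (κ * y x - deriv y x) ^ 2 := by positivity
    have := mul_le_mul_of_nonneg_left hW (inv_nonneg.2 hκ.le)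
    linarith
  linarith [mul_le_mul_of_nonneg_right young (expWeight_pos κ μ x).le]

lemma absolutelyContinuousOnInterval_sq_mul_expWeight (hy : AbsolutelyContinuousOnInterval y a b)
    (κ μ : ℝ) : AbsolutelyContinuousOnInterval (fun x => y x ^ 2 * expWeight κ μ x) a b := by
  simp only [sq]
  exact (hy.fun_mul hy).fun_mul
    (contDiff_expWeight κ μ).contDiffOn.absolutelyContinuousOnInterval

lemma hardy_expWeight (hab : a ≤ b) (hy : AbsolutelyContinuousOnInterval y a b)
    (hy_cont : Continuous y) (hW : Continuous W) (ha : y a = 0) (hκ : 0 < κ) (μ : ℝ)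
    (hderiv : ∀ᵐ x, x ∈ Ioo a b → deriv y x ^ 2 ≤ W x) :
    κ ^ 2 * ∫ x in a..b, y x ^ 2 * expWeight κ μ x ≤ ∫ x in a..b, W x * expWeight κ μ x := by
  have product_ac := absolutelyContinuousOnInterval_sq_mul_expWeight hy κ μ
  have deriv_le : ∀ᵐ x ∂volume.restrict (Icc a b),
      deriv (fun x => y x ^ 2 * expWeight κ μ x) x ≤
        κ⁻¹ * (W x * expWeight κ μ x) - κ * (y x ^ 2 * expWeight κ μ x) := by
    rw [← restrict_Ioo_eq_restrict_Icc, ae_restrict_iff' measurableSet_Ioo]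
    filter_upwards [hderiv, hy.ae_differentiableAt] with x hx_deriv hx_diff hx
    refine deriv_sq_mul_expWeight_le (hx_diff ?_) hκ (hx_deriv hx) μ
    rw [uIcc_of_le hab]
    exact Ioo_subset_Icc_self hx
  have nonneg : 0 ≤ κ⁻¹ * (∫ x in a..b, W x * expWeight κ μ x) -
      κ * ∫ x in a..b, y x ^ 2 * expWeight κ μ x :=
    calc 0 ≤ y b ^ 2 * expWeight κ μ b - y a ^ 2 * expWeight κ μ a := by
          rw [ha, zero_pow two_ne_zero, zero_mul, sub_zero]
          exact mul_nonneg (sq_nonneg _) (expWeight_pos κ μ b).le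
      _ = ∫ x in a..b, deriv (fun x => y x ^ 2 * expWeight κ μ x) x :=
          product_ac.integral_deriv_eq_sub.symm
      _ ≤ ∫ x in a..b, (κ⁻¹ * (W x * expWeight κ μ x) - κ * (y x ^ 2 * expWeight κ μ x)) :=
          intervalIntegral.integral_mono_ae_restrict hab product_ac.intervalIntegrable_deriv
            (Continuous.intervalIntegrable (by fun_prop) _ _) deriv_le
      _ = _ := by
          rw [intervalIntegral.integral_sub (Continuous.intervalIntegrable (by fun_prop) _ _)
            (Continuous.intervalIntegrable (by fun_prop) _ _),
            intervalIntegral.integral_const_mul, intervalIntegral.integral_const_mul]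
  rwa [sub_nonneg, le_inv_mul_iff₀ hκ, ← mul_assoc, ← sq] at nonneg

end AbsolutelyContinuous

lemma IsPrimitiveOn.hardy_expWeight (h : IsPrimitiveOn g g' a b) (hab : a ≤ b) (ha : g a = 0)
    {κ : ℝ} (hκ : 0 < κ) (μ : ℝ) :
    κ ^ 2 * ∫ x in a..b, g x ^ 2 * expWeight κ μ x ≤
      ∫ x in a..b, g' x ^ 2 * expWeight κ μ x := by
  refine Carleman1D.hardy_expWeight (W := fun x => g' x ^ 2) hab
    (h.absolutelyContinuousOnInterval hab) h.continuous (h.continuous_deriv.pow 2) ha hκ μ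
    (.of_forall fun x hx => ?_)
  rw [(h.hasDerivAt hx).deriv]

lemma deriv_sub_mul_sq_le {v p c : ℝ → ℝ} {v' p' x : ℝ} {K : ℝ≥0} (hv : HasDerivAt v v' x)
    (hp : HasDerivAt p p' x) (hc : DifferentiableAt ℝ c x) (hcK : ‖deriv c x‖ ≤ K) :
    deriv (fun x => v x - c x * p x) x ^ 2 ≤ 2 * (v' - c x * p') ^ 2 + 2 * K ^ 2 * p x ^ 2 := by
  have deriv_eq : deriv (fun x => v x - c x * p x) x = v' - (deriv c x * p x + c x * p') :=
    (hv.sub (hc.hasDerivAt.mul hp)).deriv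
  rw [deriv_eq]
  have deriv_c_sq : deriv c x ^ 2 ≤ (K : ℝ) ^ 2 := sq_le_sq' (abs_le.1 hcK).1 (abs_le.1 hcK).2
  have := mul_le_mul_of_nonneg_right deriv_c_sq (sq_nonneg (p x))
  nlinarith [sq_nonneg (v' - c x * p' + deriv c x * p x)]

lemma hardy_expWeight_sub_mul (hab : a ≤ b) {v v' p p' c : ℝ → ℝ} (hv : IsPrimitiveOn v v' a b)
    (hp : IsPrimitiveOn p p' a b) (hva : v a = 0) (hpa : p a = 0) (hc : Continuous c) {K : ℝ≥0}
    (hcK : LipschitzOnWith K c (Icc a b)) {κ : ℝ} (hκ : 0 < κ) (μ : ℝ) :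
    κ ^ 2 * ∫ x in a..b, (v x - c x * p x) ^ 2 * expWeight κ μ x ≤
      ∫ x in a..b, (2 * (v' x - c x * p' x) ^ 2 + 2 * K ^ 2 * p x ^ 2) * expWeight κ μ x := by
  have continuous_v := hv.continuous
  have continuous_v' := hv.continuous_deriv
  have continuous_p := hp.continuous
  have continuous_p' := hp.continuous_deriv
  have c_ac : AbsolutelyContinuousOnInterval c a b :=
    LipschitzOnWith.absolutelyContinuousOnInterval (by rwa [uIcc_of_le hab])
  refine hardy_expWeight hab ((hv.absolutelyContinuousOnInterval hab).fun_sub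
    (c_ac.fun_mul (hp.absolutelyContinuousOnInterval hab))) (by fun_prop) (by fun_prop)
    (by rw [hva, hpa, mul_zero, sub_zero]) hκ μ ?_
  filter_upwards [c_ac.ae_differentiableAt] with x hx_diff hx
  refine deriv_sub_mul_sq_le (hv.hasDerivAt hx) (hp.hasDerivAt hx) (hx_diff ?_)
    (norm_deriv_le_of_lipschitzOn (Icc_mem_nhds hx.1 hx.2) hcK)
  rw [uIcc_of_le hab]
  exact Ioo_subset_Icc_self hx

end Hardy

section Partials

variable {ε b T : ℝ}

/-- On the closed rectangle, `f` has the continuous partial derivative `fx` in `x`. -/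
structure HasPartialFst (ε b T : ℝ) (f fx : ℝ × ℝ → ℝ) : Prop where
  continuous : Continuous f
  continuous_deriv : Continuous fx
  sub_eq_integral : ∀ x ∈ Icc ε b, ∀ t ∈ Icc 0 T, f (x, t) - f (ε, t) = ∫ s in ε..x, fx (s, t)

/-- On the closed rectangle, `f` has the continuous partial derivative `ft` in `t`. -/
structure HasPartialSnd (ε b T : ℝ) (f ft : ℝ × ℝ → ℝ) : Prop where
  continuous : Continuous f
  continuous_deriv : Continuous ft
  sub_eq_integral : ∀ x ∈ Icc ε b, ∀ t ∈ Icc 0 T, f (x, t) - f (x, 0) = ∫ r in 0..t, ft (x, r)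

variable {f fx ft : ℝ × ℝ → ℝ}

lemma HasPartialFst.isPrimitiveOn (h : HasPartialFst ε b T f fx) {t : ℝ} (ht : t ∈ Icc 0 T) :
    IsPrimitiveOn (fun x => f (x, t)) (fun x => fx (x, t)) ε b :=
  ⟨h.continuous.comp (by fun_prop), h.continuous_deriv.comp (by fun_prop),
    fun x hx => h.sub_eq_integral x hx t ht⟩

lemma HasPartialSnd.isPrimitiveOn (h : HasPartialSnd ε b T f ft) {x : ℝ} (hx : x ∈ Icc ε b) :
    IsPrimitiveOn (fun t => f (x, t)) (fun t => ft (x, t)) 0 T :=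
  ⟨h.continuous.comp (by fun_prop), h.continuous_deriv.comp (by fun_prop),
    fun t ht => h.sub_eq_integral x hx t ht⟩

lemma H4.hasPartialFst_rep (hεb : ε < b) (hT : 0 < T) (u : H4 ε b T) {i i' j : Fin 5}
    (h : (i : ℕ) + (j : ℕ) ≤ 2) (h' : (i' : ℕ) + (j : ℕ) ≤ 2) (hi : (i' : ℕ) = i + 1) :
    HasPartialFst ε b T (u.rep i j h) (u.rep i' j h') :=
  ⟨u.continuous_rep hεb hT i j h, u.continuous_rep hεb hT i' j h',
    fun _ hx _ ht => u.rep_sub_eq_integral_fst hεb hT h h' hi hx ht⟩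

lemma H4.hasPartialSnd_rep (hεb : ε < b) (hT : 0 < T) (u : H4 ε b T) {i j j' : Fin 5}
    (h : (i : ℕ) + (j : ℕ) ≤ 2) (h' : (i : ℕ) + (j' : ℕ) ≤ 2) (hj : (j' : ℕ) = j + 1) :
    HasPartialSnd ε b T (u.rep i j h) (u.rep i j' h') :=
  ⟨u.continuous_rep hεb hT i j h, u.continuous_rep hεb hT i j' h',
    fun _ hx _ ht => u.rep_sub_eq_integral_snd hεb hT h h' hj hx ht⟩

end Partials

section Coefficient

open scoped NNReal

variable {ε b T : ℝ}

lemma qLow_pos (hb : 1 < b) : 0 < qLow b :=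
  one_div_pos.2 (mul_pos two_pos (Real.rpow_pos_of_pos (zero_lt_one.trans hb) _))

lemma qLow_le_half (hb : 1 < b) : qLow b ≤ 1 / 2 := by
  have one_le_rpow : 1 ≤ b ^ (1 / 4 : ℝ) := Real.one_le_rpow hb.le (by norm_num)
  exact one_div_le_one_div_of_le two_pos (by linarith)

/-- The truncation of a real number to the interval `[1 / (2 b^{1/4}), 1 / 2]`. -/
def truncate (b y : ℝ) : ℝ := max (qLow b) (min (1 / 2) y)

lemma truncate_mem_Icc (hb : 1 < b) (y : ℝ) : truncate b y ∈ Icc (qLow b) (1 / 2) :=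
  ⟨le_max_left _ _, max_le (qLow_le_half hb) (min_le_left _ _)⟩

lemma truncate_pos (hb : 1 < b) (y : ℝ) : 0 < truncate b y :=
  (qLow_pos hb).trans_le (truncate_mem_Icc hb y).1

lemma lipschitzWith_truncate (b : ℝ) : LipschitzWith 1 (truncate b) :=
  (LipschitzWith.id.const_min (1 / 2)).const_max (qLow b)

lemma qTrunc_eq_truncate (hεb : ε < b) (hT : 0 < T) (q : H4 ε b T) {x : ℝ} (hx : x ∈ Icc ε b) :
    qTrunc q x = truncate b (q.rep 0 0 (by decide) (x, 0)) := by
  rw [qTrunc, truncate, q.contRep_eqOn_rep hεb hT 0 0 (by decide) (bottom_mem_OmBar hT hx)]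

/-- The upper bound for the coefficients of `∂ₓ∂ₜ` in the operators `Aₙ`. -/
def coefMax (b : ℝ) : ℝ := 1 / (2 * qLow b ^ 2)

lemma one_div_two_mul_sq_mem_Icc {L p : ℝ} (hL : 0 < L) (hp : p ∈ Icc L (1 / 2)) :
    1 / (2 * p ^ 2) ∈ Icc 2 (1 / (2 * L ^ 2)) := by
  have p_pos : 0 < p := hL.trans_le hp.1
  constructor
  · rw [le_div_iff₀ (by positivity)]
    nlinarith [hp.2]
  · gcongr
    exact hp.1

lemma lipschitzOnWith_one_div_two_mul_sq {L : ℝ} (hL : 0 < L) :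
    LipschitzOnWith (1 / (2 * L ^ 4)).toNNReal (fun p : ℝ => 1 / (2 * p ^ 2)) (Icc L (1 / 2)) := by
  refine LipschitzOnWith.of_dist_le_mul fun p hp r hr => ?_
  have p_pos : 0 < p := hL.trans_le hp.1
  have r_pos : 0 < r := hL.trans_le hr.1
  have difference : 1 / (2 * p ^ 2) - 1 / (2 * r ^ 2) =
      (r + p) / (2 * (p ^ 2 * r ^ 2)) * (r - p) := by
    field_simp
    ring
  rw [Real.coe_toNNReal _ (by positivity), Real.dist_eq, Real.dist_eq, difference, abs_mul,
    abs_sub_comm r p, abs_of_nonneg (by positivity)]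
  gcongr
  · linarith [hp.2, hr.2]
  · calc L ^ 4 = L ^ 2 * L ^ 2 := by ring
      _ ≤ p ^ 2 * r ^ 2 := by gcongr <;> [exact hp.1; exact hr.1]

/-- The coefficient `coefA m n`, continued from `[ε, b]` to a continuous function on `ℝ` through the
representatives `H4.rep`. -/
def coefRep (m : ℕ → H4 ε b T) : ℕ → ℝ → ℝ
  | 0, _ => 2
  | k + 1, x => 1 / (2 * truncate b ((m k).rep 0 0 (by decide) (x, 0)) ^ 2)

variable (m : ℕ → H4 ε b T)

lemma coefA_eq_coefRep (hεb : ε < b) (hT : 0 < T) (n : ℕ) {x : ℝ} (hx : x ∈ Icc ε b) :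
    coefA m n x = coefRep m n x := by
  cases n with
  | zero => rfl
  | succ k => rw [coefA, coefRep, qTrunc_eq_truncate hεb hT (m k) hx]

lemma continuous_coefRep (hεb : ε < b) (hb : 1 < b) (hT : 0 < T) (n : ℕ) :
    Continuous (coefRep m n) := by
  cases n with
  | zero => exact continuous_const
  | succ k =>
    have continuous_rep := (m k).continuous_rep hεb hT 0 0 (by decide)
    have continuous_truncate := (lipschitzWith_truncate b).continuous
    refine continuous_const.div (by fun_prop) fun x => ?_
    have := truncate_pos hb ((m k).rep 0 0 (by decide) (x, 0))
    positivity

lemma coefRep_mem_Icc (hb : 1 < b) (n : ℕ) (x : ℝ) : coefRep m n x ∈ Icc 2 (coefMax b) := by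
  cases n with
  | zero =>
    exact ⟨le_rfl,
      (one_div_two_mul_sq_mem_Icc (qLow_pos hb) (left_mem_Icc.2 (qLow_le_half hb))).1⟩
  | succ k => exact one_div_two_mul_sq_mem_Icc (qLow_pos hb) (truncate_mem_Icc hb _)

/-- The Lipschitz constant of the coefficients built from functions of norm at most `R`. -/
def coefLip (ε b T R : ℝ) : ℝ≥0 :=
  (1 / (2 * qLow b ^ 4)).toNNReal * (1 * (embeddingBound ε b T * R).toNNReal)

lemma lipschitzOnWith_rep_bottom (hεb : ε < b) (hT : 0 < T) {R : ℝ} {q : H4 ε b T} (hq : ‖q‖ ≤ R) :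
    LipschitzOnWith (embeddingBound ε b T * R).toNNReal
      (fun x => q.rep 0 0 (by decide) (x, 0)) (Icc ε b) := by
  have bound_nonneg := embeddingBound_nonneg ε b T
  refine ((q.hasPartialFst_rep hεb hT (i := 0) (i' := 1) (j := 0) (by decide) (by decide)
    rfl).isPrimitiveOn
    (left_mem_Icc.2 hT.le)).lipschitzOnWith (mul_nonneg bound_nonneg ((norm_nonneg q).trans hq))
    fun s _ => ?_
  exact (q.abs_rep_le hεb hT 1 0 (by decide) _).trans (mul_le_mul_of_nonneg_left hq bound_nonneg)

variable {m} in
lemma lipschitzOnWith_coefRep (hεb : ε < b) (hb : 1 < b) (hT : 0 < T) {R : ℝ} {n : ℕ}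
    (hm : ∀ k < n, ‖m k‖ ≤ R) :
    LipschitzOnWith (coefLip ε b T R) (coefRep m n) (Icc ε b) := by
  cases n with
  | zero => exact (LipschitzWith.const' 2).lipschitzOnWith
  | succ k =>
    exact (lipschitzOnWith_one_div_two_mul_sq (qLow_pos hb)).comp
      ((lipschitzWith_truncate b).comp_lipschitzOnWith
        (lipschitzOnWith_rep_bottom hεb hT (hm k k.lt_succ_self)))
      fun _ _ => truncate_mem_Icc hb _

end Coefficient

section Operators

open scoped ENNReal

variable {ε b T : ℝ}

lemma exists_mul_clm_of_bounded {α : Type*} {mα : MeasurableSpace α} {μ : Measure α} {g : α → ℝ}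
    (hg : MemLp g ∞ μ) :
    ∃ M : Lp ℝ 2 μ →L[ℝ] Lp ℝ 2 μ, ∀ u, M u =ᵐ[μ] fun z => g z * u z := by
  refine ⟨(ContinuousLinearMap.mul ℝ ℝ).holderL μ ∞ 2 2 (hg.toLp g), fun u => ?_⟩
  filter_upwards [(ContinuousLinearMap.mul ℝ ℝ).coeFn_holder (r := 2) (hg.toLp g) u,
    hg.coeFn_toLp] with z h_mul hgz
  refine h_mul.trans ?_
  rw [hgz, ContinuousLinearMap.mul_apply']

lemma ae_mem_Om (ε b T : ℝ) : ∀ᵐ z ∂(muOm ε b T), z ∈ Om ε b T :=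
  ae_restrict_mem (measurableSet_Ioo.prod measurableSet_Ioo)

lemma Om_subset_OmBar (ε b T : ℝ) : Om ε b T ⊆ OmBar ε b T :=
  prod_mono Ioo_subset_Icc_self Ioo_subset_Icc_self

lemma exists_mul_clm {g : ℝ × ℝ → ℝ} (hg : Continuous g) :
    ∃ M : L2 ε b T →L[ℝ] L2 ε b T, ∀ u, M u =ᵐ[muOm ε b T] fun z => g z * u z := by
  obtain ⟨K, hK⟩ := (isCompact_Icc.prod isCompact_Icc :
    IsCompact (OmBar ε b T)).exists_bound_of_continuousOn hg.continuousOn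
  refine exists_mul_clm_of_bounded (memLp_top_of_bound hg.aestronglyMeasurable K ?_)
  filter_upwards [ae_mem_Om ε b T] with z hz
  exact hK z (Om_subset_OmBar ε b T hz)

/-- The weak derivative `∂ₓⁱ∂ₜʲ` as a bounded operator from `H⁴(Ω)` to `L²(Ω)`. -/
def derivCLM (i j : Fin 5) (h : (i : ℕ) + (j : ℕ) ≤ 4 := by decide) : H4 ε b T →L[ℝ] L2 ε b T :=
  LinearMap.mkContinuous
    { toFun := fun u => u.D i j h
      map_add' := fun _ _ => rfl
      map_smul' := fun _ _ => rfl } 1 fun u => (u.norm_D_le i j h).trans_eq (one_mul _).symm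

/-- The square root `e^{λφ}` of the Carleman weight. -/
def sqrtWeight (α lam : ℝ) (z : ℝ × ℝ) : ℝ := Real.exp (-lam * (z.1 + α * z.2))

lemma sqrtWeight_sq (α lam : ℝ) (z : ℝ × ℝ) : sqrtWeight α lam z ^ 2 = weight α lam z := by
  rw [sqrtWeight, weight, ← Real.exp_nat_mul]
  congr 1
  push_cast
  ring

lemma continuous_sqrtWeight (α lam : ℝ) : Continuous (sqrtWeight α lam) := by
  unfold sqrtWeight
  fun_prop

variable (hεb : ε < b) (hb : 1 < b) (hT : 0 < T) (α lam : ℝ) (m : ℕ → H4 ε b T) (n : ℕ)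

include hεb hb hT

lemma exists_opA_clm : ∃ A : H4 ε b T →L[ℝ] L2 ε b T, ∀ q : H4 ε b T,
    A q =ᵐ[muOm ε b T] fun z => sqrtWeight α lam z * opA m n q z := by
  have continuous_weight := continuous_sqrtWeight α lam
  have continuous_coef := continuous_coefRep m hεb hb hT n
  obtain ⟨M₁, hM₁⟩ := exists_mul_clm (ε := ε) (b := b) (T := T) continuous_weight
  obtain ⟨M₂, hM₂⟩ := exists_mul_clm (ε := ε) (b := b) (T := T)
    (g := fun z => sqrtWeight α lam z * coefRep m n z.1) (by fun_prop)
  refine ⟨M₁.comp (derivCLM 2 0) - M₂.comp (derivCLM 1 1), fun q => ?_⟩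
  filter_upwards [Lp.coeFn_sub (M₁ (q.D 2 0)) (M₂ (q.D 1 1)), hM₁ (q.D 2 0), hM₂ (q.D 1 1),
    ae_mem_Om ε b T] with z h_sub h_xx h_xt hz
  refine h_sub.trans ?_
  rw [Pi.sub_apply, h_xx, h_xt, opA, coefA_eq_coefRep m hεb hT n (Ioo_subset_Icc_self hz.1)]
  ring

lemma exists_termB_L2 : ∃ B : L2 ε b T,
    B =ᵐ[muOm ε b T] fun z => sqrtWeight α lam z * termB m n z := by
  cases n with
  | zero =>
    refine ⟨0, (Lp.coeFn_zero ℝ 2 (muOm ε b T)).trans (.of_forall fun z => ?_)⟩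
    exact (mul_zero _).symm
  | succ k =>
    set f := fun x => truncate b ((m k).rep 0 0 (by decide) (x, 0))
    set fx := (m k).rep 1 0 (by decide)
    have continuous_weight := continuous_sqrtWeight α lam
    have continuous_f : Continuous f := (lipschitzWith_truncate b).continuous.comp
      (((m k).continuous_rep hεb hT 0 0 (by decide)).comp (by fun_prop))
    have continuous_fx : Continuous fx := (m k).continuous_rep hεb hT 1 0 (by decide)
    have continuous_quotient : Continuous fun z : ℝ × ℝ =>
        sqrtWeight α lam z * (fx (z.1, 0) / (2 * f z.1 ^ 3)) := by
      refine continuous_weight.mul (Continuous.div (by fun_prop) (by fun_prop) fun z => ?_)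
      have := truncate_pos hb ((m k).rep 0 0 (by decide) (z.1, 0))
      positivity
    obtain ⟨M, hM⟩ := exists_mul_clm (ε := ε) (b := b) (T := T) continuous_quotient
    refine ⟨M ((m k).D 0 1), ?_⟩
    filter_upwards [hM ((m k).D 0 1), ae_mem_Om ε b T] with z hz h_mem
    have hx : z.1 ∈ Icc ε b := Ioo_subset_Icc_self h_mem.1
    rw [hz, termB, qTrunc_eq_truncate hεb hT (m k) hx,
      (m k).contRep_eqOn_rep hεb hT 1 0 (by decide) (bottom_mem_OmBar hT hx)]
    ring

lemma exists_J_eq_tikhonov (β : ℝ) : ∃ (A : H4 ε b T →L[ℝ] L2 ε b T) (B : L2 ε b T),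
    J α lam β m n = tikhonov A B β ∧
    (∀ q h : H4 ε b T, tikhonovDeriv A B β q h =
      2 * (∫ z in Om ε b T, (opA m n q z + termB m n z) * opA m n h z * weight α lam z)
        + 2 * β * inner ℝ q h) ∧
    ∀ h : H4 ε b T, ‖A h‖ ^ 2 = ∫ z in Om ε b T, opA m n h z ^ 2 * weight α lam z := by
  obtain ⟨A, hA⟩ := exists_opA_clm hεb hb hT α lam m n
  obtain ⟨B, hB⟩ := exists_termB_L2 hεb hb hT α lam m n
  have residual (q : H4 ε b T) : (A q + B : L2 ε b T) =ᵐ[muOm ε b T]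
      fun z => sqrtWeight α lam z * (opA m n q z + termB m n z) := by
    filter_upwards [Lp.coeFn_add (A q) B, hA q, hB] with z h_add hAz hBz
    rw [h_add, Pi.add_apply, hAz, hBz, mul_add]
  refine ⟨A, B, funext fun q => ?_, fun q h => ?_, fun h => ?_⟩
  · rw [J, tikhonov, norm_sq_eq_integral]
    congr 1
    refine integral_congr_ae ?_
    filter_upwards [residual q] with z hz
    rw [hz, mul_pow, sqrtWeight_sq, mul_comm]
  · rw [tikhonovDeriv_apply, L2.inner_def]
    congr 2
    refine integral_congr_ae ?_
    filter_upwards [residual q, hA h] with z hqz hhz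
    rw [hqz, hhz, ← sqrtWeight_sq, RCLike.inner_apply, conj_trivial]
    ring
  · rw [norm_sq_eq_integral]
    refine integral_congr_ae ?_
    filter_upwards [hA h] with z hz
    rw [hz, mul_pow, sqrtWeight_sq, mul_comm]

end Operators

section WeightedIntegrals

variable {ε b T : ℝ}

lemma integrable_muOm_of_continuous {f : ℝ × ℝ → ℝ} (hf : Continuous f) :
    Integrable f (muOm ε b T) :=
  (hf.continuousOn.integrableOn_compact (isCompact_Icc.prod isCompact_Icc)).mono_set
    (Om_subset_OmBar ε b T)

lemma integral_volIoo_eq {a b : ℝ} (hab : a ≤ b) (f : ℝ → ℝ) :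
    ∫ x, f x ∂(volIoo a b) = ∫ x in a..b, f x := by
  rw [volIoo, intervalIntegral.integral_of_le hab, integral_Ioc_eq_integral_Ioo]

lemma integral_Om_eq_intervalIntegral_snd_fst (hεb : ε ≤ b) (hT : 0 ≤ T) {f : ℝ × ℝ → ℝ}
    (hf : Continuous f) : ∫ z in Om ε b T, f z = ∫ t in 0..T, ∫ x in ε..b, f (x, t) := by
  have integrable := integrable_muOm_of_continuous (ε := ε) (b := b) (T := T) hf
  rw [muOm_eq_prod] at integrable
  change ∫ z, f z ∂(muOm ε b T) = _
  rw [muOm_eq_prod, integral_prod_symm _ integrable, integral_volIoo_eq hT]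
  simp_rw [integral_volIoo_eq hεb]

lemma integral_Om_eq_intervalIntegral_fst_snd (hεb : ε ≤ b) (hT : 0 ≤ T) {f : ℝ × ℝ → ℝ}
    (hf : Continuous f) : ∫ z in Om ε b T, f z = ∫ x in ε..b, ∫ t in 0..T, f (x, t) := by
  have integrable := integrable_muOm_of_continuous (ε := ε) (b := b) (T := T) hf
  rw [muOm_eq_prod] at integrable
  change ∫ z, f z ∂(muOm ε b T) = _
  rw [muOm_eq_prod, integral_prod _ integrable, integral_volIoo_eq hεb]
  simp_rw [integral_volIoo_eq hT]

lemma integral_Om_mono {f g : ℝ × ℝ → ℝ} (hf : Continuous f) (hg : Continuous g)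
    (h : ∀ z, f z ≤ g z) : ∫ z in Om ε b T, f z ≤ ∫ z in Om ε b T, g z :=
  integral_mono (integrable_muOm_of_continuous hf) (integrable_muOm_of_continuous hg) h

lemma integral_Om_add {f g : ℝ × ℝ → ℝ} (hf : Continuous f) (hg : Continuous g) :
    ∫ z in Om ε b T, (f z + g z) = (∫ z in Om ε b T, f z) + ∫ z in Om ε b T, g z :=
  integral_add (integrable_muOm_of_continuous hf) (integrable_muOm_of_continuous hg)

lemma integral_Om_mono_of_slices (hεb : ε ≤ b) (hT : 0 ≤ T) {f g : ℝ × ℝ → ℝ} (hf : Continuous f)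
    (hg : Continuous g) (h : ∀ t ∈ Icc 0 T, ∫ x in ε..b, f (x, t) ≤ ∫ x in ε..b, g (x, t)) :
    ∫ z in Om ε b T, f z ≤ ∫ z in Om ε b T, g z := by
  have continuous_slice {k : ℝ × ℝ → ℝ} (hk : Continuous k) :
      Continuous fun t => ∫ x in ε..b, k (x, t) :=
    intervalIntegral.continuous_parametric_intervalIntegral_of_continuous'
      (f := fun t x => k (x, t)) (by unfold Function.uncurry; fun_prop) ε b
  rw [integral_Om_eq_intervalIntegral_snd_fst hεb hT hf,
    integral_Om_eq_intervalIntegral_snd_fst hεb hT hg]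
  exact intervalIntegral.integral_mono_on hT ((continuous_slice hf).intervalIntegrable _ _)
    ((continuous_slice hg).intervalIntegrable _ _) h

lemma weight_eq_expWeight_fst (α lam x t : ℝ) :
    weight α lam (x, t) = expWeight lam (-2 * lam * α * t) x := by
  rw [weight, expWeight]
  congr 1
  ring

lemma weight_eq_expWeight_snd (α lam x t : ℝ) :
    weight α lam (x, t) = expWeight (lam * α) (-2 * lam * x) t := by
  rw [weight, expWeight]
  congr 1
  ring

lemma weight_pos (α lam : ℝ) (z : ℝ × ℝ) : 0 < weight α lam z := Real.exp_pos _

@[fun_prop]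
lemma continuous_weight (α lam : ℝ) : Continuous (weight α lam) := by
  unfold weight
  fun_prop

/-- The square `∫_Ω f² e^{2λφ}` of the norm of `f` in the weighted space `L²(Ω, e^{2λφ})`. -/
def weightedSq (ε b T α lam : ℝ) (f : ℝ × ℝ → ℝ) : ℝ :=
  ∫ z in Om ε b T, f z ^ 2 * weight α lam z

/-- The weighted square norm `∫ f(x, t)² e^{2λφ(x, t)} dx` of the trace of `f` on a horizontal
segment. -/
def weightedTraceSq (ε b α lam : ℝ) (f : ℝ × ℝ → ℝ) (t : ℝ) : ℝ :=
  ∫ x in ε..b, f (x, t) ^ 2 * weight α lam (x, t)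

lemma weightedSq_nonneg (ε b T α lam : ℝ) (f : ℝ × ℝ → ℝ) : 0 ≤ weightedSq ε b T α lam f :=
  integral_nonneg fun z => mul_nonneg (sq_nonneg _) (weight_pos α lam z).le

lemma weightedTraceSq_nonneg (hεb : ε ≤ b) (α lam : ℝ) (f : ℝ × ℝ → ℝ) (t : ℝ) :
    0 ≤ weightedTraceSq ε b α lam f t :=
  intervalIntegral.integral_nonneg hεb fun _ _ => mul_nonneg (sq_nonneg _) (weight_pos α lam _).le

end WeightedIntegrals

section Carleman

open scoped NNReal

variable {ε b T α lam : ℝ} {f fx v vx vt p : ℝ × ℝ → ℝ} {c : ℝ → ℝ} {cm : ℝ}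

lemma HasPartialFst.sq_mul_weightedTraceSq_le (h : HasPartialFst ε b T f fx) (hεb : ε ≤ b) {t : ℝ}
    (ht : t ∈ Icc 0 T) (h_left : f (ε, t) = 0) (hlam : 0 < lam) :
    lam ^ 2 * weightedTraceSq ε b α lam f t ≤ weightedTraceSq ε b α lam fx t := by
  simp only [weightedTraceSq, weight_eq_expWeight_fst]
  exact (h.isPrimitiveOn ht).hardy_expWeight hεb h_left hlam _

lemma HasPartialFst.sq_mul_weightedSq_le (h : HasPartialFst ε b T f fx) (hεb : ε ≤ b) (hT : 0 ≤ T)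
    (h_left : ∀ t ∈ Icc 0 T, f (ε, t) = 0) (hlam : 0 < lam) :
    lam ^ 2 * weightedSq ε b T α lam f ≤ weightedSq ε b T α lam fx := by
  have continuous_f := h.continuous
  have continuous_fx := h.continuous_deriv
  rw [weightedSq, weightedSq, ← integral_const_mul]
  refine integral_Om_mono_of_slices hεb hT (by fun_prop) (by fun_prop) fun t ht => ?_
  rw [intervalIntegral.integral_const_mul]
  exact h.sq_mul_weightedTraceSq_le hεb ht (h_left t ht) hlam

lemma HasPartialFst.integral_mul_mul_weight (h : HasPartialFst ε b T v vx) (hεb : ε ≤ b)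
    (hT : 0 ≤ T) (h_left : ∀ t ∈ Icc 0 T, v (ε, t) = 0) (h_right : ∀ t ∈ Icc 0 T, v (b, t) = 0) :
    ∫ z in Om ε b T, v z * vx z * weight α lam z = lam * weightedSq ε b T α lam v := by
  have continuous_v := h.continuous
  have continuous_vx := h.continuous_deriv
  rw [weightedSq, integral_Om_eq_intervalIntegral_snd_fst hεb hT (by fun_prop),
    integral_Om_eq_intervalIntegral_snd_fst hεb hT (by fun_prop),
    ← intervalIntegral.integral_const_mul]
  refine intervalIntegral.integral_congr fun t ht => ?_
  rw [uIcc_of_le hT] at ht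
  simp only [weight_eq_expWeight_fst]
  rw [(h.isPrimitiveOn ht).integral_mul_deriv_mul_expWeight hεb, h_left t ht, h_right t ht]
  ring

lemma HasPartialSnd.integral_slice_mul_mul_weight_le (h : HasPartialSnd ε b T v vt) (hT : 0 ≤ T)
    {x k : ℝ} (hx : x ∈ Icc ε b) (hk : k ∈ Icc 2 cm) (hα : 0 ≤ α) (hαc : α * cm ≤ 1 / 2)
    (hlam : 0 ≤ lam) :
    ∫ t in 0..T, k * (v (x, t) * vt (x, t) * weight α lam (x, t)) ≤
      cm / 2 * (v (x, T) ^ 2 * weight α lam (x, T)) - v (x, 0) ^ 2 * weight α lam (x, 0) +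
        lam / 2 * ∫ t in 0..T, v (x, t) ^ 2 * weight α lam (x, t) := by
  have top_nonneg : 0 ≤ v (x, T) ^ 2 * weight α lam (x, T) :=
    mul_nonneg (sq_nonneg _) (weight_pos _ _ _).le
  have bottom_nonneg : 0 ≤ v (x, 0) ^ 2 * weight α lam (x, 0) :=
    mul_nonneg (sq_nonneg _) (weight_pos _ _ _).le
  have interior_nonneg : 0 ≤ ∫ t in 0..T, v (x, t) ^ 2 * weight α lam (x, t) :=
    intervalIntegral.integral_nonneg hT fun t _ => mul_nonneg (sq_nonneg _) (weight_pos _ _ _).le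
  have αk_le : α * k ≤ 1 / 2 := (mul_le_mul_of_nonneg_left hk.2 hα).trans hαc
  have top_le := mul_le_mul_of_nonneg_right hk.2 top_nonneg
  have bottom_le := mul_le_mul_of_nonneg_right hk.1 bottom_nonneg
  have interior_le := mul_le_mul_of_nonneg_right (mul_le_mul_of_nonneg_left αk_le hlam)
    interior_nonneg
  simp only [weight_eq_expWeight_snd, intervalIntegral.integral_const_mul] at *
  rw [(h.isPrimitiveOn hx).integral_mul_deriv_mul_expWeight hT]
  linarith

lemma HasPartialSnd.integral_mul_mul_weight_le (h : HasPartialSnd ε b T v vt) (hεb : ε ≤ b)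
    (hT : 0 ≤ T) (hc : Continuous c) (hcm : ∀ x, c x ∈ Icc 2 cm) (hα : 0 ≤ α)
    (hαc : α * cm ≤ 1 / 2) (hlam : 0 ≤ lam) :
    ∫ z in Om ε b T, c z.1 * (v z * vt z * weight α lam z) ≤
      cm / 2 * weightedTraceSq ε b α lam v T - weightedTraceSq ε b α lam v 0 +
        lam / 2 * weightedSq ε b T α lam v := by
  have continuous_v := h.continuous
  have continuous_vt := h.continuous_deriv
  have continuous_slice {k : ℝ × ℝ → ℝ} (hk : Continuous k) :
      Continuous fun x => ∫ t in 0..T, k (x, t) :=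
    intervalIntegral.continuous_parametric_intervalIntegral_of_continuous'
      (f := fun x t => k (x, t)) (by unfold Function.uncurry; fun_prop) 0 T
  have := continuous_slice (k := fun z => v z ^ 2 * weight α lam z)
    (by fun_prop)
  have continuous_left := continuous_slice (k := fun z => c z.1 * (v z * vt z * weight α lam z))
    (by fun_prop)
  rw [weightedSq, weightedTraceSq, weightedTraceSq,
    integral_Om_eq_intervalIntegral_fst_snd hεb hT (by fun_prop),
    integral_Om_eq_intervalIntegral_fst_snd hεb hT (by fun_prop),
    ← intervalIntegral.integral_const_mul, ← intervalIntegral.integral_const_mul,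
    ← intervalIntegral.integral_sub (Continuous.intervalIntegrable (by fun_prop) _ _)
      (Continuous.intervalIntegrable (by fun_prop) _ _),
    ← intervalIntegral.integral_add (Continuous.intervalIntegrable (by fun_prop) _ _)
      (Continuous.intervalIntegrable (by fun_prop) _ _)]
  exact intervalIntegral.integral_mono_on hεb (continuous_left.intervalIntegrable _ _)
    (Continuous.intervalIntegrable (by fun_prop) _ _)
    fun x hx => h.integral_slice_mul_mul_weight_le hT hx (hcm x) hα hαc hlam

lemma mul_integral_mul_mul_weight_le (hf : Continuous f) (hv : Continuous v) (α lam : ℝ) :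
    lam * (∫ z in Om ε b T, f z * v z * weight α lam z) ≤
      weightedSq ε b T α lam f + lam ^ 2 / 4 * weightedSq ε b T α lam v := by
  rw [weightedSq, weightedSq, ← integral_const_mul, ← integral_const_mul,
    ← integral_Om_add (by fun_prop) (by fun_prop)]
  refine integral_Om_mono (by fun_prop) (by fun_prop) fun z => ?_
  linarith [mul_nonneg (sq_nonneg (f z - lam / 2 * v z)) (weight_pos α lam z).le]

-- Multiply `vₓ - c vₜ` by `λ v e^{2λφ}` and integrate by parts in each variable.
lemma carleman_transport (hεb : ε ≤ b) (hT : 0 ≤ T) (hvx : HasPartialFst ε b T v vx)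
    (hvt : HasPartialSnd ε b T v vt) (hc : Continuous c) (hcm : ∀ x, c x ∈ Icc 2 cm)
    (h_left : ∀ t ∈ Icc 0 T, v (ε, t) = 0) (h_right : ∀ t ∈ Icc 0 T, v (b, t) = 0)
    (hα : 0 ≤ α) (hαc : α * cm ≤ 1 / 2) (hlam : 0 ≤ lam) :
    lam ^ 2 / 4 * weightedSq ε b T α lam v + lam * weightedTraceSq ε b α lam v 0 ≤
      weightedSq ε b T α lam (fun z => vx z - c z.1 * vt z) +
        lam * cm / 2 * weightedTraceSq ε b α lam v T := by
  have continuous_v := hvx.continuous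
  have continuous_vx := hvx.continuous_deriv
  have continuous_vt := hvt.continuous_deriv
  have split : ∫ z in Om ε b T, (vx z - c z.1 * vt z) * v z * weight α lam z =
      (∫ z in Om ε b T, v z * vx z * weight α lam z) -
        ∫ z in Om ε b T, c z.1 * (v z * vt z * weight α lam z) := by
    rw [eq_sub_iff_add_eq, ← integral_Om_add (by fun_prop) (by fun_prop)]
    congr with z
    ring
  have young := mul_integral_mul_mul_weight_le (ε := ε) (b := b) (T := T)
    (f := fun z => vx z - c z.1 * vt z) (by fun_prop) continuous_v α lam
  rw [split, hvx.integral_mul_mul_weight hεb hT h_left h_right] at young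
  have := mul_le_mul_of_nonneg_left
    (hvt.integral_mul_mul_weight_le hεb hT hc hcm hα hαc hlam) hlam
  linarith

lemma sq_mul_weightedSq_sub_mul_le (hεb : ε ≤ b) (hT : 0 ≤ T) (hvx : HasPartialFst ε b T v vx)
    (hpx : HasPartialFst ε b T p vt) (hc : Continuous c) {K : ℝ≥0}
    (hcK : LipschitzOnWith K c (Icc ε b)) (hv_left : ∀ t ∈ Icc 0 T, v (ε, t) = 0)
    (hp_left : ∀ t ∈ Icc 0 T, p (ε, t) = 0) (hlam : 0 < lam) :
    lam ^ 2 * weightedSq ε b T α lam (fun z => v z - c z.1 * p z) ≤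
      2 * weightedSq ε b T α lam (fun z => vx z - c z.1 * vt z) +
        2 * K ^ 2 * weightedSq ε b T α lam p := by
  have continuous_v := hvx.continuous
  have continuous_vx := hvx.continuous_deriv
  have continuous_p := hpx.continuous
  have continuous_vt := hpx.continuous_deriv
  simp only [weightedSq, ← integral_const_mul]
  rw [← integral_Om_add (by fun_prop) (by fun_prop)]
  refine integral_Om_mono_of_slices hεb hT (by fun_prop) (by fun_prop) fun t ht => ?_
  simp only [intervalIntegral.integral_const_mul, weight_eq_expWeight_fst]
  refine (hardy_expWeight_sub_mul hεb (hvx.isPrimitiveOn ht) (hpx.isPrimitiveOn ht) (hv_left t ht)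
    (hp_left t ht) hc hcK hlam _).trans_eq ?_
  congr with x
  ring

lemma two_mul_weightedSq_le (hv : Continuous v) (hp : Continuous p) (hc : Continuous c)
    (hc_two : ∀ x, 2 ≤ c x) (α lam : ℝ) :
    2 * weightedSq ε b T α lam p ≤
      weightedSq ε b T α lam (fun z => v z - c z.1 * p z) + weightedSq ε b T α lam v := by
  simp only [weightedSq, ← integral_const_mul]
  rw [← integral_Om_add (by fun_prop) (by fun_prop)]
  refine integral_Om_mono (by fun_prop) (by fun_prop) fun z => ?_
  have four_le : 4 ≤ c z.1 ^ 2 := by nlinarith [hc_two z.1]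
  have pointwise : 2 * p z ^ 2 ≤ (v z - c z.1 * p z) ^ 2 + v z ^ 2 := by
    nlinarith [sq_nonneg (2 * v z - c z.1 * p z), mul_le_mul_of_nonneg_right four_le
      (sq_nonneg (p z))]
  linarith [mul_le_mul_of_nonneg_right pointwise (weight_pos α lam z).le]

-- Here `p = hₜ`, `v = hₓ` and `vt = hₓₜ`, which is why `vt` is the `x`-derivative of `p`.
lemma carleman_time_derivative (hεb : ε ≤ b) (hT : 0 ≤ T) (hvx : HasPartialFst ε b T v vx)
    (hpx : HasPartialFst ε b T p vt) (hc : Continuous c) (hc_two : ∀ x, 2 ≤ c x) {K : ℝ≥0}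
    (hcK : LipschitzOnWith K c (Icc ε b)) (hv_left : ∀ t ∈ Icc 0 T, v (ε, t) = 0)
    (hp_left : ∀ t ∈ Icc 0 T, p (ε, t) = 0) (hlam : 0 < lam) (hlamK : 2 * (K : ℝ) ^ 2 ≤ lam ^ 2) :
    lam ^ 2 * weightedSq ε b T α lam p ≤
      2 * weightedSq ε b T α lam (fun z => vx z - c z.1 * vt z) +
        lam ^ 2 * weightedSq ε b T α lam v := by
  have hardy := sq_mul_weightedSq_sub_mul_le (α := α) hεb hT hvx hpx hc hcK hv_left hp_left hlam
  have absorb := mul_le_mul_of_nonneg_right hlamK (weightedSq_nonneg ε b T α lam p)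
  have pointwise := mul_le_mul_of_nonneg_left (two_mul_weightedSq_le (ε := ε) (b := b) (T := T)
    hvx.continuous hpx.continuous hc hc_two α lam) (sq_nonneg lam)
  linarith

end Carleman

section CarlemanH40

open scoped NNReal

variable {ε b T : ℝ} {h : H4 ε b T}

lemma eqOn_zero_Icc_of_Ioo (hT : 0 < T) {g : ℝ → ℝ} (hg : Continuous g)
    (h_zero : ∀ t ∈ Ioo 0 T, g t = 0) : ∀ t ∈ Icc 0 T, g t = 0 := by
  have closure_zero : EqOn g 0 (closure (Ioo 0 T)) := EqOn.closure h_zero hg continuous_const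
  rwa [closure_Ioo hT.ne] at closure_zero

lemma HasPartialSnd.eq_zero_of_eq_zero {f ft : ℝ × ℝ → ℝ} (hf : HasPartialSnd ε b T f ft)
    (hT : 0 < T) {x : ℝ} (hx : x ∈ Icc ε b) (h_zero : ∀ t ∈ Icc 0 T, f (x, t) = 0) :
    ∀ t ∈ Icc 0 T, ft (x, t) = 0 := by
  refine eqOn_zero_Icc_of_Ioo hT (hf.continuous_deriv.comp (by fun_prop)) fun t ht => ?_
  refine ((hf.isPrimitiveOn hx).hasDerivAt ht).unique
    ((hasDerivAt_const t (0 : ℝ)).congr_of_eventuallyEq ?_)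
  filter_upwards [Icc_mem_nhds ht.1 ht.2] with s hs
  exact h_zero s hs

lemma rep_left_eq_zero_of_mem_H40 (hεb : ε < b) (hT : 0 < T) (hh : h ∈ H40 ε b T) :
    ∀ t ∈ Icc 0 T, h.rep 0 0 (by decide) (ε, t) = 0 := by
  rw [← SetLike.mem_coe, coe_H40_eq_lateralSet hεb hT] at hh
  exact eqOn_zero_Icc_of_Ioo hT ((h.continuous_rep hεb hT 0 0 (by decide)).comp (by fun_prop))
    fun t ht => (hh t ht).1

lemma rep_fst_left_eq_zero_of_mem_H40 (hεb : ε < b) (hT : 0 < T) (hh : h ∈ H40 ε b T) :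
    ∀ t ∈ Icc 0 T, h.rep 1 0 (by decide) (ε, t) = 0 := by
  rw [← SetLike.mem_coe, coe_H40_eq_lateralSet hεb hT] at hh
  exact eqOn_zero_Icc_of_Ioo hT ((h.continuous_rep hεb hT 1 0 (by decide)).comp (by fun_prop))
    fun t ht => (hh t ht).2.1

lemma rep_fst_right_eq_zero_of_mem_H40 (hεb : ε < b) (hT : 0 < T) (hh : h ∈ H40 ε b T) :
    ∀ t ∈ Icc 0 T, h.rep 1 0 (by decide) (b, t) = 0 := by
  rw [← SetLike.mem_coe, coe_H40_eq_lateralSet hεb hT] at hh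
  exact eqOn_zero_Icc_of_Ioo hT ((h.continuous_rep hεb hT 1 0 (by decide)).comp (by fun_prop))
    fun t ht => (hh t ht).2.2

/-- The left side of the Carleman estimate for `h`, a weighted `H¹` norm on `Ω` together with a
weighted norm of the traces of `h` and `∂ₓh` on `t = 0`. -/
def carlemanEnergy (α lam : ℝ) (h : H4 ε b T) : ℝ :=
  lam * (weightedSq ε b T α lam (h.rep 1 0) + weightedSq ε b T α lam (h.rep 0 1)) +
    lam ^ 3 * weightedSq ε b T α lam (h.rep 0 0) +
    (lam * weightedTraceSq ε b α lam (h.rep 1 0) 0 +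
      lam ^ 3 * weightedTraceSq ε b α lam (h.rep 0 0) 0)

lemma carlemanEnergy_le (hεb : ε < b) (hT : 0 < T) (hh : h ∈ H40 ε b T) {c : ℝ → ℝ}
    (hc : Continuous c) {cm : ℝ} (hcm : ∀ x, c x ∈ Icc 2 cm) {K : ℝ≥0}
    (hcK : LipschitzOnWith K c (Icc ε b)) {α lam : ℝ} (hα : 0 ≤ α) (hαc : α * cm ≤ 1 / 2)
    (hlam : 1 ≤ lam) (hlamK : 2 * (K : ℝ) ^ 2 ≤ lam ^ 2) :
    1 / 14 * carlemanEnergy α lam h ≤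
      weightedSq ε b T α lam
        (fun z => h.rep 2 0 (by decide) z - c z.1 * h.rep 1 1 (by decide) z) +
        lam * cm / 2 * weightedTraceSq ε b α lam (h.rep 1 0) T := by
  have lam_pos : 0 < lam := one_pos.trans_le hlam
  have h_x := h.hasPartialFst_rep hεb hT (i := 0) (i' := 1) (j := 0) (by decide) (by decide) rfl
  have h_t := h.hasPartialSnd_rep hεb hT (i := 0) (j := 0) (j' := 1) (by decide) (by decide) rfl
  have hx_x := h.hasPartialFst_rep hεb hT (i := 1) (i' := 2) (j := 0) (by decide) (by decide) rfl
  have hx_t := h.hasPartialSnd_rep hεb hT (i := 1) (j := 0) (j' := 1) (by decide) (by decide) rfl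
  have ht_x := h.hasPartialFst_rep hεb hT (i := 0) (i' := 1) (j := 1) (by decide) (by decide) rfl
  have h_left := rep_left_eq_zero_of_mem_H40 hεb hT hh
  have hx_left := rep_fst_left_eq_zero_of_mem_H40 hεb hT hh
  have ht_left := h_t.eq_zero_of_eq_zero hT (left_mem_Icc.2 hεb.le) h_left
  have hT_mem : (0 : ℝ) ∈ Icc 0 T := left_mem_Icc.2 hT.le
  have hx_le := carleman_transport hεb.le hT.le hx_x hx_t hc hcm hx_left
    (rep_fst_right_eq_zero_of_mem_H40 hεb hT hh) hα hαc lam_pos.le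
  have ht_le := carleman_time_derivative (α := α) hεb.le hT.le hx_x ht_x hc (fun x => (hcm x).1)
    hcK hx_left ht_left lam_pos hlamK
  have h_le := mul_le_mul_of_nonneg_left
    (h_x.sq_mul_weightedSq_le (α := α) hεb.le hT.le h_left lam_pos) lam_pos.le
  have h_bottom_le := mul_le_mul_of_nonneg_left
    (h_x.sq_mul_weightedTraceSq_le (α := α) hεb.le hT_mem (h_left 0 hT_mem) lam_pos) lam_pos.le
  have top_nonneg : 0 ≤ lam * cm / 2 * weightedTraceSq ε b α lam (h.rep 1 0) T := by
    have cm_nonneg : 0 ≤ cm := by linarith [(hcm 0).1, (hcm 0).2]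
    exact mul_nonneg (by positivity) (weightedTraceSq_nonneg hεb.le _ _ _ _)
  have lam_le_sq : lam ≤ lam ^ 2 := le_self_pow₀ hlam two_ne_zero
  have hx_absorb := mul_le_mul_of_nonneg_right lam_le_sq
    (weightedSq_nonneg ε b T α lam (h.rep 1 0))
  have ht_absorb := mul_le_mul_of_nonneg_right lam_le_sq
    (weightedSq_nonneg ε b T α lam (h.rep 0 1))
  have hx_bottom_nonneg := mul_nonneg lam_pos.le
    (weightedTraceSq_nonneg hεb.le α lam (h.rep 1 0) 0)
  rw [carlemanEnergy]
  linarith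

end CarlemanH40

section Absorption

variable {ε b T α lam β : ℝ} {m : ℕ → H4 ε b T} {n : ℕ} {h : H4 ε b T}

lemma carlemanEnergy_eq (hεb : ε < b) (hT : 0 < T) :
    carlemanEnergy α lam h =
      (∫ z in Om ε b T, (lam * (((h.D 1 0) z) ^ 2 + ((h.D 0 1) z) ^ 2)
        + lam ^ 3 * ((h.D 0 0) z) ^ 2) * weight α lam z) +
      ∫ x in ε..b, (lam * (contRep (h.D 1 0) (x, 0)) ^ 2
        + lam ^ 3 * (contRep (h.D 0 0) (x, 0)) ^ 2) * Real.exp (-2 * lam * x) := by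
  have continuous_h := h.continuous_rep hεb hT 0 0 (by decide)
  have continuous_hx := h.continuous_rep hεb hT 1 0 (by decide)
  have continuous_ht := h.continuous_rep hεb hT 0 1 (by decide)
  simp only [carlemanEnergy, weightedSq, weightedTraceSq, mul_add, ← integral_const_mul,
    ← intervalIntegral.integral_const_mul]
  rw [← integral_Om_add (by fun_prop) (by fun_prop), ← integral_Om_add (by fun_prop) (by fun_prop),
    ← intervalIntegral.integral_add (Continuous.intervalIntegrable (by fun_prop) _ _)
      (Continuous.intervalIntegrable (by fun_prop) _ _)]
  congr 1
  · refine integral_congr_ae ?_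
    filter_upwards [h.ae_eq_rep hεb hT 0 0 (by decide), h.ae_eq_rep hεb hT 1 0 (by decide),
      h.ae_eq_rep hεb hT 0 1 (by decide)] with z hz hz_x hz_t
    rw [hz, hz_x, hz_t]
    ring
  · refine intervalIntegral.integral_congr fun x hx => ?_
    rw [uIcc_of_le hεb.le] at hx
    have hx_bar := bottom_mem_OmBar hT hx
    simp only [h.contRep_eqOn_rep hεb hT 0 0 (by decide) hx_bar,
      h.contRep_eqOn_rep hεb hT 1 0 (by decide) hx_bar, weight, mul_zero, add_zero]
    ring

lemma integral_opA_sq_eq (hεb : ε < b) (hT : 0 < T) :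
    ∫ z in Om ε b T, opA m n h z ^ 2 * weight α lam z = weightedSq ε b T α lam
      fun z => h.rep 2 0 (by decide) z - coefRep m n z.1 * h.rep 1 1 (by decide) z := by
  refine integral_congr_ae ?_
  filter_upwards [h.ae_eq_rep hεb hT 2 0 (by decide), h.ae_eq_rep hεb hT 1 1 (by decide),
    ae_mem_Om ε b T] with z hz_xx hz_xt hz
  rw [opA, hz_xx, hz_xt, coefA_eq_coefRep m hεb hT n (Ioo_subset_Icc_self hz.1)]

lemma weightedTraceSq_rep_top_le (hε : 0 ≤ ε) (hεb : ε < b) (hT : 0 < T) (hlam : 0 ≤ lam) :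
    weightedTraceSq ε b α lam (h.rep 1 0) T ≤
      (b - ε) * (embeddingBound ε b T * ‖h‖) ^ 2 * Real.exp (-2 * lam * α * T) := by
  have continuous_hx := h.continuous_rep hεb hT 1 0 (by decide)
  have integral_le : weightedTraceSq ε b α lam (h.rep 1 0) T ≤
      ∫ _ in ε..b, (embeddingBound ε b T * ‖h‖) ^ 2 * Real.exp (-2 * lam * α * T) := by
    refine intervalIntegral.integral_mono_on hεb.le
      (Continuous.intervalIntegrable (by fun_prop) _ _)
      (continuous_const.intervalIntegrable _ _) fun x hx => ?_
    have rep_le := abs_le.1 (h.abs_rep_le hεb hT 1 0 (by decide) (x, T))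
    refine mul_le_mul (sq_le_sq' rep_le.1 rep_le.2) (Real.exp_le_exp.2 ?_) (weight_pos _ _ _).le
      (sq_nonneg _)
    linarith [mul_nonneg hlam (hε.trans hx.1)]
  rwa [intervalIntegral.integral_const, smul_eq_mul, ← mul_assoc] at integral_le

lemma mul_mul_exp_neg_le_one {K s : ℝ} (hs : 0 < s) (hlam : 0 < lam)
    (hK : 2 * K / s ^ 2 ≤ lam) : lam * K * Real.exp (-(lam * s)) ≤ 1 := by
  rw [div_le_iff₀ (by positivity)] at hK
  rw [Real.exp_neg, ← div_eq_mul_inv, div_le_one (Real.exp_pos _)]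
  have linear_nonneg : 0 ≤ 1 + lam * s := by positivity
  calc lam * K ≤ 1 + lam * s + (lam * s) ^ 2 / 2 := by
        linarith [mul_le_mul_of_nonneg_left hK hlam.le]
    _ ≤ Real.exp (lam * s) := Real.quadratic_le_exp_of_nonneg (by positivity)

/-- The constant in front of `λ e^{-2λαT} ‖h‖²` in the bound for the boundary term at `t = T`. -/
def topBound (ε b T : ℝ) : ℝ := coefMax b / 2 * ((b - ε) * embeddingBound ε b T ^ 2)

/-- The value `λ₁` from which on the Carleman estimate holds with the boundary term at `t = T`
absorbed by the penalty. -/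
def carlemanThreshold (ε b T R α : ℝ) : ℝ :=
  2 + 2 * coefLip ε b T R + 2 * topBound ε b T / (α * T) ^ 2

lemma two_le_coefMax (hb : 1 < b) : 2 ≤ coefMax b :=
  (one_div_two_mul_sq_mem_Icc (qLow_pos hb) (left_mem_Icc.2 (qLow_le_half hb))).1

lemma topBound_nonneg (hεb : ε < b) (hb : 1 < b) : 0 ≤ topBound ε b T :=
  mul_nonneg (half_pos (two_pos.trans_le (two_le_coefMax hb))).le
    (mul_nonneg (sub_pos.2 hεb).le (sq_nonneg _))

lemma le_of_carlemanThreshold_le {R : ℝ} (hεb : ε < b) (hb : 1 < b)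
    (hlam : carlemanThreshold ε b T R α ≤ lam) :
    1 < lam ∧ 2 * (coefLip ε b T R : ℝ) ^ 2 ≤ lam ^ 2 ∧
      2 * topBound ε b T / (α * T) ^ 2 ≤ lam := by
  rw [carlemanThreshold] at hlam
  have lip_nonneg := (coefLip ε b T R).coe_nonneg
  have top_nonneg : 0 ≤ 2 * topBound ε b T / (α * T) ^ 2 := by
    have := topBound_nonneg (T := T) hεb hb
    positivity
  refine ⟨by linarith, ?_, by linarith⟩
  have := pow_le_pow_left₀ (mul_nonneg two_pos.le lip_nonneg)
    (by linarith : 2 * (coefLip ε b T R : ℝ) ≤ lam) 2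
  nlinarith

lemma mul_weightedTraceSq_rep_top_le (hε : 0 ≤ ε) (hεb : ε < b) (hb : 1 < b) (hT : 0 < T)
    (hα : 0 < α) (hlam : 0 < lam) (hlam_top : 2 * topBound ε b T / (α * T) ^ 2 ≤ lam)
    (hβ : 2 * Real.exp (-lam * α * T) ≤ β) :
    lam * coefMax b / 2 * weightedTraceSq ε b α lam (h.rep 1 0) T ≤ β / 2 * ‖h‖ ^ 2 := by
  have coefMax_pos := two_pos.trans_le (two_le_coefMax hb)
  have exp_split : Real.exp (-2 * lam * α * T) =
      Real.exp (-(lam * (α * T))) * Real.exp (-lam * α * T) := by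
    rw [← Real.exp_add]
    congr 1
    ring
  calc lam * coefMax b / 2 * weightedTraceSq ε b α lam (h.rep 1 0) T
      ≤ lam * coefMax b / 2 *
        ((b - ε) * (embeddingBound ε b T * ‖h‖) ^ 2 * Real.exp (-2 * lam * α * T)) :=
        mul_le_mul_of_nonneg_left (weightedTraceSq_rep_top_le hε hεb hT hlam.le) (by positivity)
    _ = lam * topBound ε b T * Real.exp (-(lam * (α * T))) *
        (Real.exp (-lam * α * T) * ‖h‖ ^ 2) := by
        rw [exp_split, topBound]
        ring
    _ ≤ 1 * (β / 2 * ‖h‖ ^ 2) := by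
        gcongr
        · exact mul_mul_exp_neg_le_one (by positivity) hlam hlam_top
        · linarith
    _ = β / 2 * ‖h‖ ^ 2 := one_mul _

lemma carlemanEnergy_le_integral_opA_sq (hε : 0 ≤ ε) (hεb : ε < b) (hb : 1 < b) (hT : 0 < T)
    {R : ℝ} (hm : ∀ k < n, ‖m k‖ ≤ R) (hh : h ∈ H40 ε b T) (hα : 0 < α)
    (hαc : α * coefMax b ≤ 1 / 2) (hlam : carlemanThreshold ε b T R α ≤ lam)
    (hβ : 2 * Real.exp (-lam * α * T) ≤ β) :
    1 / 14 * carlemanEnergy α lam h ≤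
      (∫ z in Om ε b T, opA m n h z ^ 2 * weight α lam z) + β / 2 * ‖h‖ ^ 2 := by
  obtain ⟨one_lt_lam, hlam_lip, hlam_top⟩ := le_of_carlemanThreshold_le hεb hb hlam
  rw [integral_opA_sq_eq hεb hT]
  exact (carlemanEnergy_le hεb hT hh (continuous_coefRep m hεb hb hT n) (coefRep_mem_Icc m hb n)
    (lipschitzOnWith_coefRep hεb hb hT hm) hα.le hαc one_lt_lam.le hlam_lip).trans
    (add_le_add_right (mul_weightedTraceSq_rep_top_le hε hεb hb hT hα
      (one_pos.trans one_lt_lam) hlam_top hβ) _)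

end Absorption

section Functional

variable {ε b T : ℝ} (hεb : ε < b) (hb : 1 < b) (hT : 0 < T) {α lam β : ℝ} {m : ℕ → H4 ε b T}
  {n : ℕ}

include hεb hb hT

lemma IsFrechetDeriv.inner_eq {q : H4 ε b T} {g : H40 ε b T}
    (hg : IsFrechetDeriv (J α lam β m n) q g) {h : H4 ε b T} (hh : h ∈ H40 ε b T) :
    inner ℝ (g : H4 ε b T) h =
      2 * (∫ z in Om ε b T, (opA m n q z + termB m n z) * opA m n h z * weight α lam z) +
        2 * β * inner ℝ q h := by
  obtain ⟨A, B, J_eq, deriv_eq, -⟩ := exists_J_eq_tikhonov hεb hb hT α lam m n β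
  rw [IsFrechetDeriv, J_eq] at hg
  rw [← deriv_eq]
  exact DFunLike.congr_fun (innerSL_eq_of_hasFDerivAt hg) (⟨h, hh⟩ : H40 ε b T)

variable (α lam β m n) in
lemma exists_isFrechetDeriv_J (q : H4 ε b T) : ∃ g : H40 ε b T,
    IsFrechetDeriv (J α lam β m n) q g := by
  have := completeSpace_H40 hεb hT
  obtain ⟨A, B, J_eq, -⟩ := exists_J_eq_tikhonov hεb hb hT α lam m n β
  simp only [IsFrechetDeriv, J_eq]
  exact exists_gradient_tikhonov (H40 ε b T) q

variable (α lam β m n) in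
lemma exists_lipschitz_isFrechetDeriv_J : ∃ D : ℝ, 0 < D ∧
    ∀ {q₁ q₂ : H4 ε b T} {g₁ g₂ : H40 ε b T}, IsFrechetDeriv (J α lam β m n) q₁ g₁ →
      IsFrechetDeriv (J α lam β m n) q₂ g₂ →
      ‖(g₂ : H4 ε b T) - (g₁ : H4 ε b T)‖ ≤ D * ‖q₂ - q₁‖ := by
  obtain ⟨A, B, J_eq, -⟩ := exists_J_eq_tikhonov hεb hb hT α lam m n β
  refine ⟨2 * ‖A‖ ^ 2 + 2 * |β| + 1, by positivity, fun {q₁ q₂ g₁ g₂} hg₁ hg₂ => ?_⟩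
  rw [IsFrechetDeriv, J_eq] at hg₁ hg₂
  exact (norm_gradient_tikhonov_sub_le hg₁ hg₂).trans
    (mul_le_mul_of_nonneg_right (le_add_of_nonneg_right zero_le_one) (norm_nonneg _))

lemma IsFrechetDeriv.J_add_eq {q : H4 ε b T} {g : H40 ε b T}
    (hg : IsFrechetDeriv (J α lam β m n) q g) {h : H4 ε b T} (hh : h ∈ H40 ε b T) :
    J α lam β m n (q + h) = J α lam β m n q + inner ℝ (g : H4 ε b T) h +
      ((∫ z in Om ε b T, opA m n h z ^ 2 * weight α lam z) + β * ‖h‖ ^ 2) := by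
  obtain ⟨A, B, J_eq, deriv_eq, norm_A_sq⟩ := exists_J_eq_tikhonov hεb hb hT α lam m n β
  rw [hg.inner_eq hεb hb hT hh, ← deriv_eq, ← norm_A_sq, J_eq, tikhonov_add]

lemma IsFrechetDeriv.inner_sub_nonneg_of_isMinimizer {S : Set (H4 ε b T)} {p q : H4 ε b T}
    {g : H40 ε b T} (hg : IsFrechetDeriv (J α lam β m n) q g)
    (hp : IsMinimizer (J α lam β m n) S p) (hq : q ∈ S) (hpq : p - q ∈ H40 ε b T) (hβ : 0 ≤ β) :
    0 ≤ inner ℝ (g : H4 ε b T) (q - p) := by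
  have J_eq := hg.J_add_eq hεb hb hT hpq
  have J_le := hp.2 q hq
  have opA_nonneg : 0 ≤ ∫ z in Om ε b T, opA m n (p - q) z ^ 2 * weight α lam z :=
    integral_nonneg fun z => mul_nonneg (sq_nonneg _) (weight_pos α lam z).le
  have penalty_nonneg : 0 ≤ β * ‖p - q‖ ^ 2 := by positivity
  rw [add_sub_cancel] at J_eq
  rw [← neg_sub, inner_neg_right]
  linarith

variable {S : Set (H4 ε b T)} (hS : Convex ℝ S) (hβ : 0 < β)

include hS hβ

variable (α lam m n) in
lemma strictConvexOn_J : StrictConvexOn ℝ S (J α lam β m n) := by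
  obtain ⟨A, B, J_eq, -⟩ := exists_J_eq_tikhonov hεb hb hT α lam m n β
  rw [J_eq]
  exact strictConvexOn_tikhonov hS hβ

variable (α lam m n) in
lemma existsUnique_isMinimizer_J (hS_closed : IsClosed S) (hS_ne : S.Nonempty) :
    ∃! p, IsMinimizer (J α lam β m n) S p := by
  obtain ⟨A, B, J_eq, -⟩ := exists_J_eq_tikhonov hεb hb hT α lam m n β
  obtain ⟨p, hp, hp_min⟩ := exists_forall_tikhonov_le (A := A) (B := B) hS hS_closed hS_ne hβ
  rw [← J_eq] at hp_min
  exact ⟨p, ⟨hp, hp_min⟩, fun p' hp' => (strictConvexOn_J hεb hb hT α lam m n hS hβ).eq_of_isMinOn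
    hp'.2 hp_min hp'.1 hp⟩

end Functional

lemma IsIteration.norm_le {ε b T R α lam β : ℝ} {g₀ : ℝ → ℝ} {n : ℕ} {m : ℕ → H4 ε b T}
    (hm : IsIteration R g₀ α lam β n m) : ∀ k < n, ‖m k‖ ≤ R :=
  fun k hk => norm_le_of_mem_closure_admB (hm k hk).1

end Carleman1D

end

theorem theorem6p1_general (ε b T R : ℝ) (hε : 0 ≤ ε) (hεb : ε < b) (hb : 1 < b) (hT : 0 < T) :
    (∀ (α lam β : ℝ) (n : ℕ) (m : ℕ → H4 ε b T),
      (∀ q : H4 ε b T, ∃ g : H40 ε b T, IsFrechetDeriv (J α lam β m n) q g ∧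
        ∀ h : H40 ε b T, inner ℝ (g : H4 ε b T) (h : H4 ε b T) =
          2 * (∫ z in Om ε b T, (opA m n q z + termB m n z) * opA m n (h : H4 ε b T) z
            * weight α lam z) + 2 * β * inner ℝ q (h : H4 ε b T)) ∧
      (∃ D : ℝ, 0 < D ∧ ∀ (q₁ q₂ : H4 ε b T) (g₁ g₂ : H40 ε b T),
        IsFrechetDeriv (J α lam β m n) q₁ g₁ → IsFrechetDeriv (J α lam β m n) q₂ g₂ →
          ‖(g₂ : H4 ε b T) - (g₁ : H4 ε b T)‖ ≤ D * ‖q₂ - q₁‖)) ∧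
    (∃ α₀ : ℝ, 0 < α₀ ∧ α₀ ≤ 1 / 2 ∧ ∀ α : ℝ, 0 < α → α < α₀ →
      ∃ lam₁ C : ℝ, 1 < lam₁ ∧ 0 < C ∧
      ∀ S : Set (H4 ε b T), Convex ℝ S → IsClosed S → S.Nonempty →
        (∀ u ∈ S, ∀ v ∈ S, u - v ∈ H40 ε b T) →
      ∀ lam : ℝ, lam₁ ≤ lam → ∀ β : ℝ, 2 * Real.exp (-lam * α * T) ≤ β →
      ∀ (n : ℕ) (m : ℕ → H4 ε b T), (∀ k < n, ‖m k‖ ≤ R) →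
        StrictConvexOn ℝ S (J α lam β m n) ∧
        (∀ q h : H4 ε b T, q ∈ S → q + h ∈ S →
          ∀ g : H40 ε b T, IsFrechetDeriv (J α lam β m n) q g →
            C * (∫ z in Om ε b T, (lam * (((h.D 1 0) z) ^ 2 + ((h.D 0 1) z) ^ 2)
                + lam ^ 3 * ((h.D 0 0) z) ^ 2) * weight α lam z)
              + C * (∫ x in ε..b, (lam * (contRep (h.D 1 0) (x, 0)) ^ 2
                + lam ^ 3 * (contRep (h.D 0 0) (x, 0)) ^ 2) * Real.exp (-2 * lam * x))
              + β / 2 * ‖h‖ ^ 2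
            ≤ J α lam β m n (q + h) - J α lam β m n q - inner ℝ (g : H4 ε b T) h) ∧
        (∃! p : H4 ε b T, IsMinimizer (J α lam β m n) S p) ∧
        (∀ p : H4 ε b T, IsMinimizer (J α lam β m n) S p → ∀ q ∈ S,
          ∀ g : H40 ε b T, IsFrechetDeriv (J α lam β m n) q g →
            0 ≤ inner ℝ (g : H4 ε b T) (q - p))) := by
  refine ⟨fun α lam β n m => ⟨fun q => ?_, ?_⟩, ?_⟩
  · obtain ⟨g, hg⟩ := exists_isFrechetDeriv_J hεb hb hT α lam β m n q
    exact ⟨g, hg, fun h => hg.inner_eq hεb hb hT h.2⟩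
  · obtain ⟨D, D_pos, lipschitz⟩ := exists_lipschitz_isFrechetDeriv_J hεb hb hT α lam β m n
    exact ⟨D, D_pos, fun _ _ _ _ => lipschitz⟩
  have two_le := two_le_coefMax hb
  refine ⟨1 / (2 * coefMax b), by positivity, one_div_le_one_div_of_le two_pos (by linarith),
    fun α hα hα_lt => ?_⟩
  have hαc : α * coefMax b ≤ 1 / 2 := by
    rw [lt_div_iff₀ (by positivity)] at hα_lt
    linarith
  refine ⟨carlemanThreshold ε b T R α, 1 / 14, (le_of_carlemanThreshold_le hεb hb le_rfl).1,
    by norm_num, fun S hS hS_closed hS_ne hS_sub lam hlam β hβ n m hm => ?_⟩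
  have hβ_pos : 0 < β := (by positivity : 0 < 2 * Real.exp (-lam * α * T)).trans_le hβ
  refine ⟨strictConvexOn_J hεb hb hT α lam m n hS hβ_pos, fun q h hq hqh g hg => ?_,
    existsUnique_isMinimizer_J hεb hb hT α lam m n hS hβ_pos hS_closed hS_ne, fun p hp q hq g hg =>
      hg.inner_sub_nonneg_of_isMinimizer hεb hb hT hp hq (hS_sub p hp.1 q hq) hβ_pos.le⟩
  have hh : h ∈ H40 ε b T := by simpa only [add_sub_cancel_left] using hS_sub _ hqh q hq
  have carleman := carlemanEnergy_le_integral_opA_sq hε hεb hb hT hm hh hα hαc hlam hβ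
  rw [carlemanEnergy_eq hεb hT] at carleman
  rw [hg.J_add_eq hεb hb hT hh]
  linarith

theorem theorem6p1 (ε b T R : ℝ) (hε : 0 < ε) (hε1 : ε < 1) (hb : 1 < b) (hT : 0 < T)
    (hR : 0 < R) :
    -- parts 1 and 2
    (∀ (α lam β : ℝ) (g₀ : ℝ → ℝ), 0 < α → α < 1 / 2 → (admB ε b T R g₀).Nonempty →
      ∀ (n : ℕ) (m : ℕ → H4 ε b T), IsIteration R g₀ α lam β n m →
        (∀ q ∈ closure (admB ε b T R g₀), ∃ g : H40 ε b T,
          IsFrechetDeriv (J α lam β m n) q g ∧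
          ∀ h : H40 ε b T, inner ℝ (g : H4 ε b T) (h : H4 ε b T) =
            2 * (∫ z in Om ε b T, (opA m n q z + termB m n z) * opA m n (h : H4 ε b T) z
              * weight α lam z) + 2 * β * inner ℝ q (h : H4 ε b T)) ∧
        (∃ D : ℝ, 0 < D ∧
          ∀ q₁ ∈ closure (admB ε b T R g₀), ∀ q₂ ∈ closure (admB ε b T R g₀),
          ∀ g₁ g₂ : H40 ε b T, IsFrechetDeriv (J α lam β m n) q₁ g₁ →
            IsFrechetDeriv (J α lam β m n) q₂ g₂ →
            ‖(g₂ : H4 ε b T) - (g₁ : H4 ε b T)‖ ≤ D * ‖q₂ - q₁‖)) ∧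
    -- parts 3 and 4
    (∃ α₀ : ℝ, 0 < α₀ ∧ α₀ ≤ 1 / 2 ∧ ∀ α : ℝ, 0 < α → α < α₀ →
      ∃ lam₁ C : ℝ, 1 < lam₁ ∧ 0 < C ∧
      ∀ g₀ : ℝ → ℝ, (admB ε b T R g₀).Nonempty →
      ∀ lam : ℝ, lam₁ ≤ lam → ∀ β : ℝ, 2 * Real.exp (-lam * α * T) ≤ β → β < 1 →
      ∀ (n : ℕ) (m : ℕ → H4 ε b T), IsIteration R g₀ α lam β n m →
        StrictConvexOn ℝ (closure (admB ε b T R g₀)) (J α lam β m n) ∧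
        (∀ q h : H4 ε b T, q ∈ closure (admB ε b T R g₀) → q + h ∈ closure (admB ε b T R g₀) →
          ∀ g : H40 ε b T, IsFrechetDeriv (J α lam β m n) q g →
            C * (∫ z in Om ε b T, (lam * (((h.D 1 0) z) ^ 2 + ((h.D 0 1) z) ^ 2)
                + lam ^ 3 * ((h.D 0 0) z) ^ 2) * weight α lam z)
              + C * (∫ x in ε..b, (lam * (contRep (h.D 1 0) (x, 0)) ^ 2
                + lam ^ 3 * (contRep (h.D 0 0) (x, 0)) ^ 2) * Real.exp (-2 * lam * x))
              + β / 2 * ‖h‖ ^ 2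
            ≤ J α lam β m n (q + h) - J α lam β m n q - inner ℝ (g : H4 ε b T) h) ∧
        (∃! p : H4 ε b T, IsMinimizer (J α lam β m n) (closure (admB ε b T R g₀)) p) ∧
        (∀ p : H4 ε b T, IsMinimizer (J α lam β m n) (closure (admB ε b T R g₀)) p →
          ∀ q ∈ closure (admB ε b T R g₀),
          ∀ g : H40 ε b T, IsFrechetDeriv (J α lam β m n) q g →
            0 ≤ inner ℝ (g : H4 ε b T) (q - p))) := by
  obtain ⟨derivatives, α₀, α₀_pos, α₀_le, convexity⟩ :=
    theorem6p1_general ε b T R hε.le (hε1.trans hb) hb hT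
  refine ⟨fun α lam β g₀ _ _ _ n m _ => ?_, α₀, α₀_pos, α₀_le, fun α hα hα_lt => ?_⟩
  · obtain ⟨gradient, D, D_pos, lipschitz⟩ := derivatives α lam β n m
    exact ⟨fun q _ => gradient q, D, D_pos, fun q₁ _ q₂ _ => lipschitz q₁ q₂⟩
  · obtain ⟨lam₁, C, one_lt, C_pos, estimates⟩ := convexity α hα hα_lt
    exact ⟨lam₁, C, one_lt, C_pos, fun g₀ hne lam hlam β hβ _ n m hm => estimates
      (closure (admB ε b T R g₀)) convex_admB.closure isClosed_closure hne.closure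
      (fun _ hu _ hv => sub_mem_H40_of_mem_closure_admB (hε1.trans hb) hT hu hv) lam hlam β hβ n m
      hm.norm_le⟩
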